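/- Let $n\in\{2,3\}$, let $W(s)=(s^2-1)^2/4$ and $c_0=\int_{-1}^1\sqrt{2W(s)}\,ds$. For a bounded open set $\Omega\subset\mathbb R^n$ let $X=X(\Omega)$ be the set of $u\in W^{2,2}_{loc}(\mathbb R^n)$ with $u=-1$ almost everywhere outside $\Omega$, and for $\varepsilon>0$ let $$\mathcal W_\varepsilon(u)=\frac1{c_0}\int_\Omega\frac1\varepsilon\Big(\varepsilon\,\Delta u-\frac1\varepsilon W'(u)\Big)^2dx\quad\text{for }u\in X,\qquad \mathcal W_\varepsilon(u)=+\infty\quad\text{otherwise.}$$ **Lemma.** For every $\bar\alpha\in[0,\infty)$ there is a constant $C$, depending only on $\bar\alpha$ and $n$, such that the following holds. Let $\Omega\subset\mathbb R^n$ be open and bounded, and let $(u_\varepsilon)_{\varepsilon>0}$ be a family in $X(\Omega)$ with $\limsup_{\varepsilon\to0}\mathcal W_\varepsilon(u_\varepsilon)\le\bar\alpha$. Then there is $\varepsilon_0>0$ such that for all $0<\varepsilon<\varepsilon_0$: 1. $\|u_\varepsilon\|_{L^\infty(\mathbb R^n)}\le C$; 2. $u_\varepsilon$ has a continuous representative,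 and this representative satisfies $$|u_\varepsilon(x)-u_\varepsilon(y)|\le\frac{C}{\sqrt\varepsilon}\,|x-y|^{1/2}\qquad\text{for all }x\in\mathbb R^n,\ y\in B(x,\varepsilon).$$ -/

import Mathlib

open Set Filter Topology MeasureTheory
open scoped NNReal ENNReal ContDiff

namespace PhaseField

/-- `g` is the weak partial derivative of `u` on `ℝⁿ` in the `i`-th coordinate direction:
both are locally integrable and `∫ u ∂ᵢφ = - ∫ g φ` for all smooth compactly supported `φ`. -/
def HasWeakPartialDeriv {n : ℕ} (i : Fin n) (u g : EuclideanSpace ℝ (Fin n) → ℝ) : Prop :=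
  LocallyIntegrable u volume ∧ LocallyIntegrable g volume ∧
    ∀ φ : EuclideanSpace ℝ (Fin n) → ℝ, ContDiff ℝ ∞ φ → HasCompactSupport φ →
      ∫ x, u x * fderiv ℝ φ x (EuclideanSpace.single i 1) = - ∫ x, g x * φ x

open Classical in
/-- A representative of the weak partial derivative (it is unique up to null sets);
`0` if there is no weak partial derivative. -/
noncomputable def weakPartialDeriv {n : ℕ} (i : Fin n) (u : EuclideanSpace ℝ (Fin n) → ℝ) :
    EuclideanSpace ℝ (Fin n) → ℝ :=
  if h : ∃ g, HasWeakPartialDeriv i u g then h.choose else 0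

/-- The weak Laplacian `∑ᵢ ∂ᵢ∂ᵢ u`. -/
noncomputable def weakLaplacian {n : ℕ} (u : EuclideanSpace ℝ (Fin n) → ℝ) :
    EuclideanSpace ℝ (Fin n) → ℝ :=
  fun x => ∑ i, weakPartialDeriv i (weakPartialDeriv i u) x

/-- `u ∈ L²_loc(ℝⁿ)`. -/
def MemL2Loc {n : ℕ} (u : EuclideanSpace ℝ (Fin n) → ℝ) : Prop :=
  ∀ K : Set (EuclideanSpace ℝ (Fin n)), IsCompact K → MemLp u 2 (volume.restrict K)

/-- `u ∈ W^{2,2}_loc(ℝⁿ)`: `u` and all its weak partial derivatives of first and second order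
exist and lie in `L²_loc(ℝⁿ)`. -/
def MemW22Loc {n : ℕ} (u : EuclideanSpace ℝ (Fin n) → ℝ) : Prop :=
  MemL2Loc u ∧ ∃ (g : Fin n → EuclideanSpace ℝ (Fin n) → ℝ)
      (h : Fin n → Fin n → EuclideanSpace ℝ (Fin n) → ℝ),
    (∀ i, MemL2Loc (g i) ∧ HasWeakPartialDeriv i u (g i)) ∧
    (∀ i j, MemL2Loc (h i j) ∧ HasWeakPartialDeriv j (g i) (h i j))

/-- The space `X` of functions in `W^{2,2}_loc(ℝⁿ)` with `u ≡ -1` (almost everywhere)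
outside `Ω`. -/
def phaseFieldSpace {n : ℕ} (Ω : Set (EuclideanSpace ℝ (Fin n))) :
    Set (EuclideanSpace ℝ (Fin n) → ℝ) :=
  {u | MemW22Loc u ∧ ∀ᵐ x ∂volume, x ∉ Ω → u x = -1}

/-- The double-well potential `W(s) = (s² - 1)² / 4`. -/
noncomputable def doubleWell (s : ℝ) : ℝ := (s ^ 2 - 1) ^ 2 / 4

/-- The normalising constant `c₀ = ∫_{-1}^{1} √(2 W(s)) ds`. -/
noncomputable def surfaceConst : ℝ := ∫ s in (-1 : ℝ)..1, √(2 * doubleWell s)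

open Classical in
/-- The diffuse Willmore functional
`𝒲_ε(u) = (1 / c₀) ∫_Ω (1 / ε) (ε Δu - W'(u) / ε)² dx` for `u ∈ X`, and `+∞` otherwise. -/
noncomputable def diffuseWillmore {n : ℕ} (Ω : Set (EuclideanSpace ℝ (Fin n))) (ε : ℝ)
    (u : EuclideanSpace ℝ (Fin n) → ℝ) : ℝ≥0∞ :=
  if u ∈ phaseFieldSpace Ω then
    ENNReal.ofReal (1 / surfaceConst) *
      ∫⁻ x in Ω, ENNReal.ofReal
        (1 / ε * (ε * weakLaplacian u x - 1 / ε * deriv doubleWell (u x)) ^ 2)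
  else ⊤

end PhaseField

/-!
The Gaussian average `G_r v (x) = ∫ v (x + r z) dγ(z)` satisfies `∂_r G_r v = r G_r Δv`. By the
Cauchy–Schwarz inequality `|G_r h| ≤ C r ^ (-d / 2) ‖h‖₂`, so in dimension `d ≤ 3` and for
`r ≤ 1` the integrand `r |G_r Δv|` is at most a multiple of `r ^ (-1 / 2)`, which is integrable at
`0`. If `v` is bounded and `Δv ∈ L^∞ + L²`, integrating over `(0, |x - y|)`, together with the
corresponding gradient bound on `(|x - y|, 1)`, therefore gives a `1/2`-Hölder estimate for `v`.

The dilation by `ε` turns the energy bound into an `L²` bound on `f = Δu - (u³ - u)`, since its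
Jacobian is harmless for `d ≤ 3`. The cubic has the good sign for a maximum principle: by Kato's
inequality `w = √(1 + u²) - 2` satisfies `w ≤ Δw + |f|`, so that `e ^ (-r² / 2) G_r w` decreases
in `r` by at most `C √r ‖f‖₂`. Comparing `r = 0` with `r = 1` bounds `sup w` by
`e ^ (-1 / 2) sup w + C ‖f‖₂`, hence `u` in terms of the energy. The cubic is then bounded too,
and the Hölder estimate applies.

These estimates are proved for smooth functions and pass to `W^{2,2}_loc` by mollification. The
energy only sees `Ω`, but `Δu - (u³ - u)` vanishes outside `Ω`: weak derivatives vanish almost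
everywhere on level sets, in particular on `{u = -1}`.
-/

namespace PhaseField

open Laplacian InnerProductSpace
open Module (finrank)

section SmoothConstAtInfty

variable {E : Type*} [NormedAddCommGroup E] [NormedSpace ℝ E] {v : E → ℝ}

theorem contDiff_fderiv_apply (hv : ContDiff ℝ ∞ v) (e : E) :
    ContDiff ℝ ∞ fun x => fderiv ℝ v x e :=
  (hv.fderiv_right (by simp)).clm_apply contDiff_const

/-- Smooth functions that are constant near infinity. Mollified elements of the phase field space
are of this kind, and the class is stable under differentiation and smooth change of values. -/
structure SmoothConstAtInfty (v : E → ℝ) : Prop where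
  contDiff : ContDiff ℝ ∞ v
  exists_hasCompactSupport_sub : ∃ c, HasCompactSupport fun x => v x - c

namespace SmoothConstAtInfty

theorem of_hasCompactSupport (hv : ContDiff ℝ ∞ v) (hc : HasCompactSupport v) :
    SmoothConstAtInfty v :=
  ⟨hv, 0, by simpa using hc⟩

theorem continuous (hv : SmoothConstAtInfty v) : Continuous v :=
  hv.contDiff.continuous

theorem exists_abs_le (hv : SmoothConstAtInfty v) : ∃ B, ∀ x, |v x| ≤ B := by
  obtain ⟨c, hc⟩ := hv.exists_hasCompactSupport_sub
  obtain ⟨B, hB⟩ := hc.exists_bound_of_continuous (hv.continuous.sub continuous_const)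
  refine ⟨B + |c|, fun x => ?_⟩
  calc |v x| = |v x - c + c| := by rw [sub_add_cancel]
    _ ≤ |v x - c| + |c| := abs_add_le _ _
    _ ≤ B + |c| := by gcongr; exact hB x

theorem hasCompactSupport_fderiv (hv : SmoothConstAtInfty v) :
    HasCompactSupport (fderiv ℝ v) := by
  obtain ⟨c, hc⟩ := hv.exists_hasCompactSupport_sub
  have h : fderiv ℝ v = fderiv ℝ fun x => v x - c := by ext1 x; rw [fderiv_sub_const]
  exact h ▸ hc.fderiv ℝ

theorem fderiv_apply (hv : SmoothConstAtInfty v) (e : E) :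
    SmoothConstAtInfty fun x => fderiv ℝ v x e :=
  of_hasCompactSupport (contDiff_fderiv_apply hv.contDiff e)
    (hv.hasCompactSupport_fderiv.comp_left (g := fun L : E →L[ℝ] ℝ => L e) (by simp))

theorem comp {g : ℝ → ℝ} (hg : ContDiff ℝ ∞ g) (hv : SmoothConstAtInfty v) :
    SmoothConstAtInfty fun x => g (v x) := by
  obtain ⟨c, hc⟩ := hv.exists_hasCompactSupport_sub
  refine ⟨hg.comp hv.contDiff, g c, ?_⟩
  simpa [Function.comp_def] using hc.comp_left (g := fun t => g (t + c) - g c) (by simp)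

end SmoothConstAtInfty

end SmoothConstAtInfty

section Laplacian

variable {E : Type*} [NormedAddCommGroup E] [InnerProductSpace ℝ E] [FiniteDimensional ℝ E]
  {v : E → ℝ}

theorem laplacian_eq_sum_fderiv_fderiv {ι : Type*} [Fintype ι] (b : OrthonormalBasis ι ℝ E)
    (hv : ContDiff ℝ 2 v) (x : E) :
    Δ v x = ∑ i, fderiv ℝ (fun y => fderiv ℝ v y (b i)) x (b i) := by
  rw [laplacian_eq_iteratedFDeriv_orthonormalBasis v b]
  refine Finset.sum_congr rfl fun i _ => ?_
  have hdiff : DifferentiableAt ℝ (fderiv ℝ v) x :=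
    (hv.fderiv_right (m := 1) le_rfl).differentiable one_ne_zero x
  rw [iteratedFDeriv_two_apply, fderiv_clm_apply hdiff (differentiableAt_const _)]
  simp

theorem contDiff_laplacian (hv : ContDiff ℝ ∞ v) : ContDiff ℝ ∞ (Δ v) := by
  have hsum : Δ v = fun x => ∑ i, fderiv ℝ (fun y => fderiv ℝ v y (stdOrthonormalBasis ℝ E i)) x
      (stdOrthonormalBasis ℝ E i) :=
    funext (laplacian_eq_sum_fderiv_fderiv _ (contDiff_infty.1 hv 2))
  rw [hsum]
  exact ContDiff.sum fun i _ => contDiff_fderiv_apply (contDiff_fderiv_apply hv _) _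

theorem support_laplacian_subset : Function.support (Δ v) ⊆ tsupport v := by
  refine fun x => not_imp_not.1 fun hx => ?_
  rw [Function.notMem_support]
  have hzero := (laplacian_congr_nhds (notMem_tsupport_iff_eventuallyEq.1 hx)).eq_of_nhds
  exact hzero.trans (congr_fun (laplacian_const (c := (0 : ℝ))) x)

theorem laplacian_sub_const (hv : ContDiff ℝ 2 v) (c : ℝ) : Δ (fun x => v x - c) = Δ v := by
  ext x
  have h := hv.contDiffAt.laplacian_sub (contDiffAt_const (c := c) (x := x))
  have hconst : Δ (fun _ : E => c) = (0 : E → ℝ) := laplacian_const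
  rwa [hconst, Pi.zero_apply, sub_zero] at h

theorem SmoothConstAtInfty.hasCompactSupport_laplacian (hv : SmoothConstAtInfty v) :
    HasCompactSupport (Δ v) := by
  obtain ⟨c, hc⟩ := hv.exists_hasCompactSupport_sub
  rw [← laplacian_sub_const (contDiff_infty.1 hv.contDiff 2) c]
  exact hc.mono' support_laplacian_subset

theorem SmoothConstAtInfty.laplacian (hv : SmoothConstAtInfty v) : SmoothConstAtInfty (Δ v) :=
  of_hasCompactSupport (contDiff_laplacian hv.contDiff) hv.hasCompactSupport_laplacian

end Laplacian

section Gaussian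

variable {E : Type*} [NormedAddCommGroup E] [InnerProductSpace ℝ E] [FiniteDimensional ℝ E]
  [MeasurableSpace E] [BorelSpace E] {h k v : E → ℝ}

theorem integrable_exp_neg_mul_norm_sq {b : ℝ} (hb : 0 < b) :
    Integrable fun z : E => Real.exp (-b * ‖z‖ ^ 2) := by
  refine not_imp_comm.1 integral_undef ?_
  rw [GaussianFourier.integral_rexp_neg_mul_sq_norm hb]
  positivity

variable (E) in
/-- The normalising constant of the standard Gaussian density. -/
noncomputable def gaussConst : ℝ := ∫ z : E, Real.exp (-(1 / 2) * ‖z‖ ^ 2)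

theorem gaussConst_pos : 0 < gaussConst E := by
  rw [gaussConst, GaussianFourier.integral_rexp_neg_mul_sq_norm (by norm_num)]
  positivity

/-- The density of the standard Gaussian measure on `E`. -/
noncomputable def gauss (z : E) : ℝ := (gaussConst E)⁻¹ * Real.exp (-(1 / 2) * ‖z‖ ^ 2)

theorem gauss_nonneg (z : E) : 0 ≤ gauss z :=
  mul_nonneg (inv_nonneg.2 gaussConst_pos.le) (Real.exp_pos _).le

theorem integrable_gauss : Integrable (gauss : E → ℝ) :=
  (integrable_exp_neg_mul_norm_sq (by norm_num)).const_mul _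

theorem integral_gauss : ∫ z : E, gauss z = 1 := by
  simp only [gauss, integral_const_mul]
  exact inv_mul_cancel₀ gaussConst_pos.ne'

theorem hasFDerivAt_gauss (z : E) : HasFDerivAt gauss (-(gauss z • innerSL ℝ z)) z := by
  have hsq : HasFDerivAt (fun z : E => ‖z‖ ^ 2) (2 • innerSL ℝ z) z :=
    (hasStrictFDerivAt_norm_sq z).hasFDerivAt
  refine ((hsq.const_mul (-(1 / 2))).exp.const_mul (gaussConst E)⁻¹).congr_fderiv ?_
  ext w
  simp [gauss]
  ring

@[fun_prop]
theorem continuous_gauss : Continuous (gauss : E → ℝ) :=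
  continuous_iff_continuousAt.2 fun z => (hasFDerivAt_gauss z).continuousAt

theorem mul_exp_neg_sq_le_two (t : ℝ) : t * Real.exp (-(1 / 4) * t ^ 2) ≤ 2 := by
  have hexp := Real.add_one_le_exp (1 / 4 * t ^ 2)
  have hle : t ≤ 2 * Real.exp (1 / 4 * t ^ 2) := by nlinarith [sq_nonneg (t - 1)]
  rwa [neg_mul, Real.exp_neg, ← div_eq_mul_inv, div_le_iff₀ (Real.exp_pos _)]

theorem norm_mul_gauss_le (z : E) :
    ‖z‖ * gauss z ≤ 2 * (gaussConst E)⁻¹ * Real.exp (-(1 / 4) * ‖z‖ ^ 2) := by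
  have hc : 0 ≤ (gaussConst E)⁻¹ * Real.exp (-(1 / 4) * ‖z‖ ^ 2) :=
    mul_nonneg (inv_nonneg.2 gaussConst_pos.le) (Real.exp_pos _).le
  have hsplit : Real.exp (-(1 / 2) * ‖z‖ ^ 2) =
      Real.exp (-(1 / 4) * ‖z‖ ^ 2) * Real.exp (-(1 / 4) * ‖z‖ ^ 2) := by
    rw [← Real.exp_add]; congr 1; ring
  have := mul_le_mul_of_nonneg_right (mul_exp_neg_sq_le_two ‖z‖) hc
  rw [gauss, hsplit]
  linarith

theorem norm_mul_gauss_nonneg (z : E) : 0 ≤ ‖z‖ * gauss z :=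
  mul_nonneg (norm_nonneg z) (gauss_nonneg z)

theorem integrable_norm_mul_gauss : Integrable fun z : E => ‖z‖ * gauss z := by
  refine (((integrable_exp_neg_mul_norm_sq (b := 1 / 4) (by norm_num)).const_mul
    (2 * (gaussConst E)⁻¹))).mono' (by fun_prop) (ae_of_all _ fun z => ?_)
  rw [Real.norm_of_nonneg (norm_mul_gauss_nonneg z)]
  exact norm_mul_gauss_le z

theorem memLp_exp_neg_mul_norm_sq {b : ℝ} (hb : 0 < b) :
    MemLp (fun z : E => Real.exp (-b * ‖z‖ ^ 2)) 2 := by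
  rw [memLp_two_iff_integrable_sq (by fun_prop)]
  refine (integrable_exp_neg_mul_norm_sq (b := 2 * b) (by positivity)).congr
    (ae_of_all _ fun z => ?_)
  dsimp only
  rw [← Real.exp_nat_mul]
  congr 1; push_cast; ring

theorem memLp_gauss : MemLp (gauss : E → ℝ) 2 :=
  (memLp_exp_neg_mul_norm_sq (by norm_num)).const_mul _

theorem memLp_norm_mul_gauss : MemLp (fun z : E => ‖z‖ * gauss z) 2 := by
  refine ((memLp_exp_neg_mul_norm_sq (b := 1 / 4) (by norm_num)).const_mul
    (2 * (gaussConst E)⁻¹)).mono' (by fun_prop) (ae_of_all _ fun z => ?_)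
  rw [Real.norm_of_nonneg (norm_mul_gauss_nonneg z)]
  exact norm_mul_gauss_le z

end Gaussian

section SquareIntegrable

theorem abs_integral_mul_le_lpNorm_mul_lpNorm {α : Type*} [MeasurableSpace α] {μ : Measure α}
    {f g : α → ℝ} (hf : MemLp f 2 μ) (hg : MemLp g 2 μ) :
    |∫ x, f x * g x ∂μ| ≤ lpNorm f 2 μ * lpNorm g 2 μ := by
  have hhölder := integral_mul_norm_le_Lp_mul_Lq (f := f) (g := g) Real.HolderConjugate.two_two
    (by rwa [ENNReal.ofReal_ofNat]) (by rwa [ENNReal.ofReal_ofNat])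
  calc |∫ x, f x * g x ∂μ| ≤ ∫ x, ‖f x‖ * ‖g x‖ ∂μ := by
        simpa only [norm_mul, Real.norm_eq_abs] using
          norm_integral_le_integral_norm (μ := μ) fun x => f x * g x
    _ ≤ lpNorm f 2 μ * lpNorm g 2 μ := by
        simpa [lpNorm_eq_integral_norm_rpow_toReal, hf.1, hg.1] using hhölder

theorem measurableEmbedding_add_smul {E : Type*} [NormedAddCommGroup E] [NormedSpace ℝ E]
    [MeasurableSpace E] [BorelSpace E] {r : ℝ} (hr : r ≠ 0) (y : E) :
    MeasurableEmbedding fun z : E => y + r • z :=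
  ((Homeomorph.smulOfNeZero r hr).trans (Homeomorph.addLeft y)).measurableEmbedding

variable {E : Type*} [NormedAddCommGroup E] [InnerProductSpace ℝ E] [FiniteDimensional ℝ E]
  [MeasurableSpace E] [BorelSpace E] {h : E → ℝ} {r : ℝ}

theorem map_add_smul_volume (hr : r ≠ 0) (y : E) :
    Measure.map (fun z : E => y + r • z) volume =
      ENNReal.ofReal |(r ^ finrank ℝ E)⁻¹| • volume := by
  rw [← Function.comp_def (y + ·) (r • ·),
    ← Measure.map_map (measurable_const_add y) (measurable_const_smul r),
    Measure.map_addHaar_smul volume hr, Measure.map_smul, map_add_left_eq_self]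

theorem ae_comp_add_smul {p : E → Prop} (hp : ∀ᵐ x, p x) (hr : r ≠ 0) (y : E) :
    ∀ᵐ z, p (y + r • z) := by
  refine (measurableEmbedding_add_smul hr y).ae_map_iff.1 ?_
  rw [map_add_smul_volume hr y]
  exact Measure.ae_smul_measure hp _

theorem lintegral_comp_add_smul (h : E → ℝ≥0∞) (hr : r ≠ 0) (y : E) :
    ∫⁻ z, h (y + r • z) = ENNReal.ofReal |(r ^ finrank ℝ E)⁻¹| * ∫⁻ z, h z := by
  rw [← (measurableEmbedding_add_smul hr y).lintegral_map, map_add_smul_volume hr y,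
    lintegral_smul_measure, smul_eq_mul]

theorem memLp_comp_add_smul (hh : MemLp h 2) (hr : r ≠ 0) (y : E) :
    MemLp (fun z => h (y + r • z)) 2 := by
  refine (measurableEmbedding_add_smul hr y).memLp_map_measure_iff.1 ?_
  rw [map_add_smul_volume hr y]
  exact hh.smul_measure ENNReal.ofReal_ne_top

theorem lpNorm_comp_add_smul (hh : AEStronglyMeasurable h) (hr : 0 < r) (y : E) :
    lpNorm (fun z => h (y + r • z)) 2 volume = √((r ^ finrank ℝ E)⁻¹) * lpNorm h 2 volume := by
  have hmap := map_add_smul_volume hr.ne' y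
  have hemb := measurableEmbedding_add_smul hr.ne' y
  have hcomp : AEStronglyMeasurable fun z => h (y + r • z) := by
    refine hemb.aestronglyMeasurable_map_iff.1 ?_
    exact hmap ▸ hh.smul_measure _
  rw [← toReal_eLpNorm hcomp, ← toReal_eLpNorm hh,
    ← Function.comp_def h, ← hemb.eLpNorm_map_measure, hmap,
    eLpNorm_smul_measure_of_ne_top (by simp), smul_eq_mul, ENNReal.toReal_mul,
    ← ENNReal.toReal_rpow, ENNReal.toReal_ofReal (abs_nonneg _), Real.sqrt_eq_rpow,
    abs_of_pos (by positivity)]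
  simp

end SquareIntegrable

section GaussAvg

variable {E : Type*} [NormedAddCommGroup E] [InnerProductSpace ℝ E] [FiniteDimensional ℝ E]
  [MeasurableSpace E] [BorelSpace E] {h h' k v : E → ℝ} {B r : ℝ}

theorem abs_integral_mul_comp_le_of_abs_le (hk : Integrable k) (hB : ∀ x, |h x| ≤ B) (y : E)
    (r : ℝ) : |∫ z, k z * h (y + r • z)| ≤ (∫ z, |k z|) * B := by
  rw [← integral_mul_const, ← Real.norm_eq_abs]
  refine norm_integral_le_of_norm_le (hk.abs.mul_const B) (ae_of_all _ fun z => ?_)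
  rw [norm_mul]
  exact mul_le_mul_of_nonneg_left (hB _) (abs_nonneg _)

theorem abs_integral_mul_comp_le_of_memLp (hk : MemLp k 2) (hh : MemLp h 2) (hr : 0 < r)
    (y : E) : |∫ z, k z * h (y + r • z)| ≤
      lpNorm k 2 volume * lpNorm h 2 volume * √((r ^ finrank ℝ E)⁻¹) := by
  refine (abs_integral_mul_le_lpNorm_mul_lpNorm hk (memLp_comp_add_smul hh hr.ne' y)).trans_eq ?_
  rw [lpNorm_comp_add_smul hh.1 hr]
  ring

theorem sqrt_inv_pow_le {d : ℕ} (hd : d ≤ 3) (hr : 0 < r) (hr1 : r ≤ 1) :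
    √((r ^ d)⁻¹) ≤ r ^ (-(3 / 2) : ℝ) := by
  calc √((r ^ d)⁻¹) ≤ √((r ^ 3)⁻¹) :=
        Real.sqrt_le_sqrt (inv_anti₀ (by positivity) (pow_le_pow_of_le_one hr.le hr1 hd))
    _ = r ^ (-(3 / 2) : ℝ) := by
        rw [Real.sqrt_eq_rpow, ← Real.rpow_natCast, ← Real.rpow_neg hr.le, ← Real.rpow_mul hr.le]
        norm_num

theorem mul_rpow_neg_three_halves (hr : 0 < r) :
    r * r ^ (-(3 / 2) : ℝ) = r ^ (-(1 / 2) : ℝ) := by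
  rw [← Real.rpow_one_add' hr.le (by norm_num)]
  norm_num

/-- The average `∫ h (x + r z) dγ(z)` for the standard Gaussian measure `γ`: the solution of the
heat equation with initial value `h`, at time `r² / 2`. -/
noncomputable def gaussAvg (r : ℝ) (h : E → ℝ) (x : E) : ℝ := ∫ z, gauss z * h (x + r • z)

theorem integrable_mul_comp_add_smul (hk : Integrable k) (hh : Continuous h)
    (hB : ∀ x, |h x| ≤ B) (x : E) (r : ℝ) : Integrable fun z => k z * h (x + r • z) :=
  hk.mul_bdd (c := B) (by fun_prop) (ae_of_all _ fun z => hB _)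

theorem continuous_gaussAvg (hh : Continuous h) (hB : ∀ x, |h x| ≤ B) (x : E) :
    Continuous fun r => gaussAvg r h x := by
  refine continuous_of_dominated (bound := fun z => gauss z * B) (fun r => by fun_prop)
    (fun r => ae_of_all _ fun z => ?_) (integrable_gauss.mul_const B)
    (ae_of_all _ fun z => by fun_prop)
  rw [norm_mul, Real.norm_of_nonneg (gauss_nonneg z)]
  exact mul_le_mul_of_nonneg_left (hB _) (gauss_nonneg z)

theorem gaussAvg_mono {B' : ℝ} (hh : Continuous h) (hB : ∀ x, |h x| ≤ B)
    (hh' : Continuous h') (hB' : ∀ x, |h' x| ≤ B') (hle : ∀ x, h x ≤ h' x) (r : ℝ) (x : E) :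
    gaussAvg r h x ≤ gaussAvg r h' x :=
  integral_mono (integrable_mul_comp_add_smul integrable_gauss hh hB x r)
    (integrable_mul_comp_add_smul integrable_gauss hh' hB' x r)
    fun _ => mul_le_mul_of_nonneg_left (hle _) (gauss_nonneg _)

theorem gaussAvg_add {B' : ℝ} (hh : Continuous h) (hB : ∀ x, |h x| ≤ B)
    (hh' : Continuous h') (hB' : ∀ x, |h' x| ≤ B') (r : ℝ) (x : E) :
    gaussAvg r (fun y => h y + h' y) x = gaussAvg r h x + gaussAvg r h' x := by
  simp only [gaussAvg, mul_add]
  exact integral_add (integrable_mul_comp_add_smul integrable_gauss hh hB x r)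
    (integrable_mul_comp_add_smul integrable_gauss hh' hB' x r)

theorem gaussAvg_const (r c : ℝ) (x : E) : gaussAvg r (fun _ => c) x = c := by
  simp [gaussAvg, integral_mul_const, integral_gauss]

theorem gaussAvg_zero (h : E → ℝ) (x : E) : gaussAvg 0 h x = h x := by
  simp [gaussAvg, integral_mul_const, integral_gauss]

theorem abs_gaussAvg_le_of_abs_le (hB : ∀ x, |h x| ≤ B) (r : ℝ) (x : E) :
    |gaussAvg r h x| ≤ B := by
  simpa [gaussAvg, abs_of_nonneg (gauss_nonneg _), integral_gauss] using
    abs_integral_mul_comp_le_of_abs_le integrable_gauss hB x r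

theorem abs_gaussAvg_le_of_memLp (hd : finrank ℝ E ≤ 3) (hh : MemLp h 2) (hr : 0 < r)
    (hr1 : r ≤ 1) (x : E) : |gaussAvg r h x| ≤
      lpNorm (gauss : E → ℝ) 2 volume * lpNorm h 2 volume * r ^ (-(3 / 2) : ℝ) := by
  refine (abs_integral_mul_comp_le_of_memLp memLp_gauss hh hr x).trans ?_
  exact mul_le_mul_of_nonneg_left (sqrt_inv_pow_le hd hr hr1)
    (mul_nonneg lpNorm_nonneg lpNorm_nonneg)

theorem hasDerivAt_integral_gauss_mul_comp (hv : SmoothConstAtInfty v) {p w : E → E}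
    (hp : Continuous p) (hw : Continuous w) (hwi : Integrable fun z => ‖w z‖ * gauss z) (t : ℝ) :
    HasDerivAt (fun t => ∫ z, gauss z * v (p z + t • w z))
      (∫ z, gauss z * fderiv ℝ v (p z + t • w z) (w z)) t := by
  obtain ⟨B, hB⟩ := hv.exists_abs_le
  have hvc := hv.continuous
  have hdv : Continuous (fderiv ℝ v) := hv.contDiff.continuous_fderiv (by simp)
  obtain ⟨L, hL⟩ := hv.hasCompactSupport_fderiv.exists_bound_of_continuous hdv
  refine (hasDerivAt_integral_of_dominated_loc_of_deriv_le (s := univ)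
    (F' := fun t z => gauss z * fderiv ℝ v (p z + t • w z) (w z))
    (bound := fun z => L * (‖w z‖ * gauss z)) univ_mem
    (Eventually.of_forall fun t => by fun_prop)
    (integrable_gauss.mul_bdd (c := B) (by fun_prop) (ae_of_all _ fun z => hB _))
    (by fun_prop) (ae_of_all _ fun z t _ => ?_) (hwi.const_mul L)
    (ae_of_all _ fun z t _ => ?_)).2
  · rw [norm_mul, Real.norm_of_nonneg (gauss_nonneg z), mul_comm (gauss z), ← mul_assoc]
    exact mul_le_mul_of_nonneg_right ((fderiv ℝ v _).le_of_opNorm_le (hL _) _) (gauss_nonneg z)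
  · have hline : HasDerivAt (fun t : ℝ => p z + t • w z) (w z) t := by
      simpa using ((hasDerivAt_id t).smul_const (w z)).const_add (p z)
    exact ((hv.contDiff.differentiable (by simp) _).hasFDerivAt.comp_hasDerivAt t hline).const_mul _

theorem integrable_inner_mul_gauss (e : E) : Integrable fun z : E => inner ℝ z e * gauss z := by
  refine (integrable_norm_mul_gauss.const_mul ‖e‖).mono' (by fun_prop) (ae_of_all _ fun z => ?_)
  rw [norm_mul, Real.norm_of_nonneg (gauss_nonneg z), ← mul_assoc, mul_comm ‖e‖]
  exact mul_le_mul_of_nonneg_right (norm_inner_le_norm z e) (gauss_nonneg z)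

/-- Stein's identity: an integration by parts, since `∂ₑ gauss z = -⟪z, e⟫ gauss z`. -/
theorem integral_inner_mul_gauss_mul_comp (hv : SmoothConstAtInfty v) (e y : E) (r : ℝ) :
    ∫ z, inner ℝ z e * gauss z * v (y + r • z) =
      r * gaussAvg r (fun x => fderiv ℝ v x e) y := by
  obtain ⟨B, hB⟩ := hv.exists_abs_le
  obtain ⟨B', hB'⟩ := (hv.fderiv_apply e).exists_abs_le
  have hgauss (z : E) : fderiv ℝ gauss z e = -(inner ℝ z e * gauss z) := by
    rw [(hasFDerivAt_gauss z).fderiv]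
    simp [mul_comm]
  have hcomp (z : E) : HasFDerivAt (fun z => v (y + r • z))
      ((fderiv ℝ v (y + r • z)).comp (r • ContinuousLinearMap.id ℝ E)) z :=
    (hv.contDiff.differentiable (by simp) _).hasFDerivAt.comp z
      (((hasFDerivAt_id z).const_smul r).const_add y)
  have hcomp' (z : E) : fderiv ℝ (fun z => v (y + r • z)) z e = r * fderiv ℝ v (y + r • z) e := by
    rw [(hcomp z).fderiv]
    simp
  have hdiff := integrable_mul_comp_add_smul integrable_gauss (hv.fderiv_apply e).continuous hB' y r
  have hparts := integral_mul_fderiv_eq_neg_fderiv_mul_of_integrable (μ := volume)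
    (f := gauss) (g := fun z => v (y + r • z)) (v := e)
    (by simpa only [hgauss, neg_mul, Pi.neg_def] using
      (integrable_mul_comp_add_smul (integrable_inner_mul_gauss e) hv.continuous hB y r).neg)
    (by simpa only [hcomp', mul_left_comm] using hdiff.const_mul r)
    (integrable_mul_comp_add_smul integrable_gauss hv.continuous hB y r)
    (fun z _ => (hasFDerivAt_gauss z).differentiableAt)
    (fun z _ => (hcomp z).differentiableAt)
  simp only [hgauss, hcomp', neg_mul, integral_neg, neg_neg, mul_left_comm _ r,
    integral_const_mul] at hparts
  exact hparts.symm

theorem hasDerivAt_gaussAvg (hv : SmoothConstAtInfty v) (x : E) (r : ℝ) :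
    HasDerivAt (fun r => gaussAvg r v x) (r * gaussAvg r (Δ v) x) r := by
  refine (hasDerivAt_integral_gauss_mul_comp hv (p := fun _ => x) (w := id) continuous_const
    continuous_id integrable_norm_mul_gauss r).congr_deriv ?_
  let b := stdOrthonormalBasis ℝ E
  have hexpand (z : E) : gauss z * fderiv ℝ v (x + r • z) z =
      ∑ i, inner ℝ z (b i) * gauss z * fderiv ℝ v (x + r • z) (b i) := by
    conv_lhs => enter [2, 2]; rw [← b.sum_repr' z]
    simp only [map_sum, map_smul, smul_eq_mul, Finset.mul_sum, real_inner_comm]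
    exact Finset.sum_congr rfl fun i _ => by ring
  have hint (i) : Integrable fun z => inner ℝ z (b i) * gauss z * fderiv ℝ v (x + r • z) (b i) :=
    have ⟨_, hB⟩ := (hv.fderiv_apply (b i)).exists_abs_le
    integrable_mul_comp_add_smul (integrable_inner_mul_gauss _)
      (hv.fderiv_apply _).continuous hB x r
  have hint' (i) : Integrable fun z =>
      gauss z * fderiv ℝ (fun y => fderiv ℝ v y (b i)) (x + r • z) (b i) :=
    have ⟨_, hB⟩ := ((hv.fderiv_apply (b i)).fderiv_apply (b i)).exists_abs_le
    integrable_mul_comp_add_smul integrable_gauss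
      ((hv.fderiv_apply _).fderiv_apply _).continuous hB x r
  simp only [id, hexpand]
  rw [integral_finsetSum _ fun i _ => hint i]
  simp only [integral_inner_mul_gauss_mul_comp (hv.fderiv_apply _), gaussAvg,
    laplacian_eq_sum_fderiv_fderiv b (contDiff_infty.1 hv.contDiff 2), Finset.mul_sum]
  rw [integral_finsetSum _ fun i _ => hint' i, Finset.mul_sum]

theorem abs_gaussAvg_sub_le (hv : SmoothConstAtInfty v) {C : ℝ} (x y : E) (r : ℝ)
    (hC : ∀ p, |∫ z, inner ℝ z (x - y) * gauss z * v (p + r • z)| ≤ C) :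
    |r * (gaussAvg r v x - gaussAvg r v y)| ≤ C := by
  have hderiv (t : ℝ) : HasDerivAt (fun t => r * ∫ z, gauss z * v (y + r • z + t • (x - y)))
      (∫ z, inner ℝ z (x - y) * gauss z * v (y + t • (x - y) + r • z)) t := by
    refine ((hasDerivAt_integral_gauss_mul_comp hv (p := fun z => y + r • z)
      (w := fun _ => x - y) (by fun_prop) continuous_const
      (integrable_gauss.const_mul _) t).const_mul r).congr_deriv ?_
    rw [integral_inner_mul_gauss_mul_comp hv]
    simp only [gaussAvg, add_right_comm]
  have hmvt := norm_image_sub_le_of_norm_deriv_le_segment_01'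
    (fun t _ => (hderiv t).hasDerivWithinAt) (fun t _ => hC _)
  have hx (z : E) : y + r • z + (x - y) = x + r • z := by abel
  simpa [gaussAvg, mul_sub, hx] using hmvt

end GaussAvg

section SingularIntegrals

variable {g : ℝ → ℝ} {a d : ℝ}

theorem abs_integral_le_of_abs_le_rpow_neg_half (hd : 0 ≤ d)
    (hg : ∀ r ∈ Ioc 0 d, |g r| ≤ a * r ^ (-(1 / 2) : ℝ)) :
    |∫ r in (0 : ℝ)..d, g r| ≤ 2 * a * √d := by
  have hint : IntervalIntegrable (fun r : ℝ => r ^ (-(1 / 2) : ℝ)) volume 0 d :=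
    intervalIntegral.intervalIntegrable_rpow' (by norm_num)
  calc |∫ r in (0 : ℝ)..d, g r| ≤ ∫ r in (0 : ℝ)..d, a * r ^ (-(1 / 2) : ℝ) :=
        intervalIntegral.norm_integral_le_of_norm_le (f := g) hd (ae_of_all _ hg) (hint.const_mul a)
    _ = 2 * a * √d := by
        rw [intervalIntegral.integral_const_mul, integral_rpow (Or.inl (by norm_num)),
          Real.sqrt_eq_rpow]
        norm_num
        ring

theorem abs_integral_le_of_abs_le_rpow_neg_three_halves (hd : 0 < d) (hd1 : d ≤ 1) (ha : 0 ≤ a)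
    (hg : ∀ r ∈ Ioc d 1, |g r| ≤ a * d * r ^ (-(3 / 2) : ℝ)) :
    |∫ r in d..1, g r| ≤ 2 * a * √d := by
  have h0 : (0 : ℝ) ∉ uIcc d 1 := by
    rw [uIcc_of_le hd1]
    exact fun h => hd.not_ge h.1
  have hint : IntervalIntegrable (fun r : ℝ => r ^ (-(3 / 2) : ℝ)) volume d 1 :=
    intervalIntegral.intervalIntegrable_rpow (Or.inr h0)
  have hsqrt : d * d ^ (-(1 / 2) : ℝ) = √d := by
    rw [← Real.rpow_one_add' hd.le (by norm_num), Real.sqrt_eq_rpow]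
    norm_num
  calc |∫ r in d..1, g r| ≤ ∫ r in d..1, a * d * r ^ (-(3 / 2) : ℝ) :=
        intervalIntegral.norm_integral_le_of_norm_le (f := g) hd1 (ae_of_all _ hg)
          (hint.const_mul _)
    _ = 2 * a * (d * d ^ (-(1 / 2) : ℝ) - d) := by
        rw [intervalIntegral.integral_const_mul, integral_rpow (Or.inr ⟨by norm_num, h0⟩),
          Real.one_rpow, show (-(3 / 2) + 1 : ℝ) = -(1 / 2) by norm_num]
        ring
    _ ≤ 2 * a * √d := by
        rw [hsqrt]
        gcongr
        linarith

end SingularIntegrals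

section SmoothEstimates

variable {E : Type*} [NormedAddCommGroup E] [InnerProductSpace ℝ E] [FiniteDimensional ℝ E]
  [MeasurableSpace E] [BorelSpace E] {v h h₁ : E → ℝ} {M M₁ : ℝ}

theorem SmoothConstAtInfty.continuous_gaussAvg (hv : SmoothConstAtInfty v) (x : E) :
    Continuous fun r => gaussAvg r v x :=
  have ⟨_, hB⟩ := hv.exists_abs_le
  PhaseField.continuous_gaussAvg hv.continuous hB x

theorem SmoothConstAtInfty.memLp_laplacian (hv : SmoothConstAtInfty v) : MemLp (Δ v) 2 :=
  hv.laplacian.continuous.memLp_of_hasCompactSupport hv.hasCompactSupport_laplacian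

theorem integral_mul_gaussAvg_laplacian (hv : SmoothConstAtInfty v) (x : E) (a b : ℝ) :
    ∫ r in a..b, r * gaussAvg r (Δ v) x = gaussAvg b v x - gaussAvg a v x :=
  intervalIntegral.integral_eq_sub_of_hasDerivAt (fun r _ => hasDerivAt_gaussAvg hv x r)
    ((continuous_id.mul (hv.laplacian.continuous_gaussAvg x)).intervalIntegrable _ _)

theorem mul_abs_gaussAvg_le_of_memLp (hd : finrank ℝ E ≤ 3) (hh : MemLp h 2) {r : ℝ}
    (hr : r ∈ Ioc (0 : ℝ) 1) (x : E) : r * |gaussAvg r h x| ≤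
      lpNorm (gauss : E → ℝ) 2 volume * lpNorm h 2 volume * r ^ (-(1 / 2) : ℝ) := by
  refine (mul_le_mul_of_nonneg_left
    (abs_gaussAvg_le_of_memLp hd hh hr.1 hr.2 x) hr.1.le).trans_eq ?_
  rw [mul_left_comm, mul_rpow_neg_three_halves hr.1]

theorem abs_le_lpNorm_add_lpNorm_laplacian (hd : finrank ℝ E ≤ 3) (hv : SmoothConstAtInfty v)
    (hv2 : MemLp v 2) (x : E) : |v x| ≤
      lpNorm (gauss : E → ℝ) 2 volume * (lpNorm v 2 volume + 2 * lpNorm (Δ v) 2 volume) := by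
  have hftc := integral_mul_gaussAvg_laplacian hv x 0 1
  have hint := abs_integral_le_of_abs_le_rpow_neg_half (g := fun r => r * gaussAvg r (Δ v) x)
    zero_le_one fun r hr => by
      rw [abs_mul, abs_of_pos hr.1]
      exact mul_abs_gaussAvg_le_of_memLp hd hv.memLp_laplacian hr x
  have hone := abs_gaussAvg_le_of_memLp hd hv2 one_pos le_rfl x
  rw [gaussAvg_zero] at hftc
  rw [Real.one_rpow, mul_one] at hone
  rw [Real.sqrt_one, mul_one, hftc, abs_sub_comm] at hint
  calc |v x| = |(v x - gaussAvg 1 v x) + gaussAvg 1 v x| := by rw [sub_add_cancel]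
    _ ≤ |v x - gaussAvg 1 v x| + |gaussAvg 1 v x| := abs_add_le _ _
    _ ≤ _ := by linarith

theorem abs_inner_mul_gauss_le (z e : E) : |inner ℝ z e * gauss z| ≤ ‖e‖ * (‖z‖ * gauss z) := by
  rw [abs_mul, abs_of_nonneg (gauss_nonneg z), ← mul_assoc, mul_comm ‖e‖]
  exact mul_le_mul_of_nonneg_right (abs_real_inner_le_norm z e) (gauss_nonneg z)

theorem abs_integral_inner_mul_gauss_mul_le (hM : ∀ x, |h x| ≤ M) (e p : E) (r : ℝ) :
    |∫ z, inner ℝ z e * gauss z * h (p + r • z)| ≤ ‖e‖ * ((∫ z : E, ‖z‖ * gauss z) * M) := by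
  have hM0 : 0 ≤ M := (abs_nonneg _).trans (hM 0)
  refine (abs_integral_mul_comp_le_of_abs_le (integrable_inner_mul_gauss e) hM p r).trans ?_
  rw [← mul_assoc, ← integral_const_mul]
  exact mul_le_mul_of_nonneg_right (integral_mono (integrable_inner_mul_gauss e).abs
    (integrable_norm_mul_gauss.const_mul _) fun z => abs_inner_mul_gauss_le z e) hM0

theorem abs_integral_inner_mul_gauss_mul_le_of_memLp (hd : finrank ℝ E ≤ 3) (hh : MemLp h 2)
    (e p : E) {r : ℝ} (hr : r ∈ Ioc (0 : ℝ) 1) :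
    |∫ z, inner ℝ z e * gauss z * h (p + r • z)| ≤
      ‖e‖ * (lpNorm (fun z : E => ‖z‖ * gauss z) 2 volume * lpNorm h 2 volume) *
        r ^ (-(3 / 2) : ℝ) := by
  have hmem : MemLp (fun z : E => ‖e‖ * (‖z‖ * gauss z)) 2 := memLp_norm_mul_gauss.const_mul ‖e‖
  have hkernel : lpNorm (fun z => inner ℝ z e * gauss z) 2 volume ≤
      ‖e‖ * lpNorm (fun z : E => ‖z‖ * gauss z) 2 volume := by
    refine (lpNorm_mono_real hmem fun z => abs_inner_mul_gauss_le z e).trans_eq ?_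
    exact (lpNorm_const_smul ‖e‖ (fun z : E => ‖z‖ * gauss z) volume).trans (by simp)
  have hmem' : MemLp (fun z => inner ℝ z e * gauss z) 2 :=
    hmem.mono' (by fun_prop) (ae_of_all _ fun z => abs_inner_mul_gauss_le z e)
  refine (abs_integral_mul_comp_le_of_memLp hmem' hh hr.1 p).trans ?_
  rw [← mul_assoc ‖e‖]
  have hpow := sqrt_inv_pow_le hd hr.1 hr.2
  exact mul_le_mul (mul_le_mul_of_nonneg_right hkernel lpNorm_nonneg) hpow (Real.sqrt_nonneg _)
    (mul_nonneg (mul_nonneg (norm_nonneg e) lpNorm_nonneg) lpNorm_nonneg)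

theorem integral_mul_comp_eq_add_sub {k : E → ℝ} {B B' : ℝ} (hk : Integrable k)
    (hh : Continuous h) (hB : ∀ x, |h x| ≤ B) (hh₁ : Continuous h₁) (hB' : ∀ x, |h₁ x| ≤ B')
    (p : E) (r : ℝ) : ∫ z, k z * h (p + r • z) =
      (∫ z, k z * h₁ (p + r • z)) + ∫ z, k z * (h (p + r • z) - h₁ (p + r • z)) := by
  have hint := integrable_mul_comp_add_smul hk hh hB p r
  have hint₁ := integrable_mul_comp_add_smul hk hh₁ hB' p r
  simp only [mul_sub]
  rw [integral_sub hint hint₁, add_sub_cancel]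

theorem abs_mul_gaussAvg_le (hd : finrank ℝ E ≤ 3) (hh : SmoothConstAtInfty h)
    (hh₁ : Continuous h₁) (hM₁ : ∀ x, |h₁ x| ≤ M₁) (h2 : MemLp (fun x => h x - h₁ x) 2) {r : ℝ}
    (hr : r ∈ Ioc (0 : ℝ) 1) (x : E) : |r * gaussAvg r h x| ≤
      (M₁ + lpNorm (gauss : E → ℝ) 2 volume * lpNorm (fun x => h x - h₁ x) 2 volume) *
        r ^ (-(1 / 2) : ℝ) := by
  obtain ⟨B, hB⟩ := hh.exists_abs_le
  have hM0 : 0 ≤ M₁ := (abs_nonneg _).trans (hM₁ 0)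
  have hr0 : 0 ≤ r := hr.1.le
  have hpow : r ≤ r ^ (-(1 / 2) : ℝ) :=
    hr.2.trans (Real.one_le_rpow_of_pos_of_le_one_of_nonpos hr.1 hr.2 (by norm_num))
  have hbounded : r * |gaussAvg r h₁ x| ≤ M₁ * r ^ (-(1 / 2) : ℝ) := by
    rw [mul_comm]
    gcongr
    exact abs_gaussAvg_le_of_abs_le hM₁ r x
  have hsplit : gaussAvg r h x = gaussAvg r h₁ x + gaussAvg r (fun x => h x - h₁ x) x :=
    integral_mul_comp_eq_add_sub integrable_gauss hh.continuous hB hh₁ hM₁ x r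
  calc |r * gaussAvg r h x|
      ≤ r * |gaussAvg r h₁ x| + r * |gaussAvg r (fun x => h x - h₁ x) x| := by
        rw [abs_mul, abs_of_pos hr.1, hsplit, ← mul_add]
        gcongr
        exact abs_add_le _ _
    _ ≤ _ := by
        rw [add_mul]
        exact add_le_add hbounded (mul_abs_gaussAvg_le_of_memLp hd h2 hr x)

theorem abs_mul_gaussAvg_sub_le (hd : finrank ℝ E ≤ 3) (hh : SmoothConstAtInfty h)
    (hh₁ : Continuous h₁) (hM₁ : ∀ x, |h₁ x| ≤ M₁) (h2 : MemLp (fun x => h x - h₁ x) 2) {r : ℝ}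
    (hr : r ∈ Ioc (0 : ℝ) 1) (x y : E) : |r * (gaussAvg r h x - gaussAvg r h y)| ≤
      ((∫ z : E, ‖z‖ * gauss z) * M₁ + lpNorm (fun z : E => ‖z‖ * gauss z) 2 volume *
        lpNorm (fun x => h x - h₁ x) 2 volume) * dist x y * r ^ (-(3 / 2) : ℝ) := by
  obtain ⟨B, hB⟩ := hh.exists_abs_le
  have hM0 : 0 ≤ M₁ := (abs_nonneg _).trans (hM₁ 0)
  have hA : 0 ≤ ∫ z : E, ‖z‖ * gauss z := integral_nonneg norm_mul_gauss_nonneg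
  have hpow : 1 ≤ r ^ (-(3 / 2) : ℝ) :=
    Real.one_le_rpow_of_pos_of_le_one_of_nonpos hr.1 hr.2 (by norm_num)
  refine abs_gaussAvg_sub_le hh x y r fun p => ?_
  rw [integral_mul_comp_eq_add_sub (integrable_inner_mul_gauss _) hh.continuous hB hh₁ hM₁,
    dist_eq_norm]
  have hbounded := (abs_integral_inner_mul_gauss_mul_le hM₁ (x - y) p r).trans
    (le_mul_of_one_le_right (by positivity) hpow)
  have hsquare := abs_integral_inner_mul_gauss_mul_le_of_memLp hd h2 (x - y) p hr
  exact (abs_add_le _ _).trans ((add_le_add hbounded hsquare).trans_eq (by ring))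

theorem integral_mul_gaussAvg_laplacian_sub (hv : SmoothConstAtInfty v) (x y : E) (c : ℝ) :
    (∫ r in (0 : ℝ)..c, r * (gaussAvg r (Δ v) x - gaussAvg r (Δ v) y)) +
      ∫ r in c..1, r * (gaussAvg r (Δ v) x - gaussAvg r (Δ v) y) =
        (gaussAvg 1 v x - gaussAvg 1 v y) - (v x - v y) := by
  have hint (z : E) (a b : ℝ) : IntervalIntegrable (fun r => r * gaussAvg r (Δ v) z) volume a b :=
    (continuous_id.mul (hv.laplacian.continuous_gaussAvg z)).intervalIntegrable a b
  simp only [mul_sub]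
  rw [intervalIntegral.integral_add_adjacent_intervals ((hint x _ _).sub (hint y _ _))
      ((hint x _ _).sub (hint y _ _)), intervalIntegral.integral_sub (hint x _ _) (hint y _ _),
    integral_mul_gaussAvg_laplacian hv, integral_mul_gaussAvg_laplacian hv, gaussAvg_zero,
    gaussAvg_zero]
  ring

theorem abs_sub_le_sqrt_dist_of_laplacian (hd : finrank ℝ E ≤ 3) (hv : SmoothConstAtInfty v)
    (hM : ∀ x, |v x| ≤ M) (hh₁ : Continuous h₁) (hM₁ : ∀ x, |h₁ x| ≤ M₁)
    (h2 : MemLp (fun x => Δ v x - h₁ x) 2) {x y : E} (hxy : dist x y ≤ 1) :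
    |v x - v y| ≤ ((∫ z : E, ‖z‖ * gauss z) * M +
      4 * (M₁ + lpNorm (gauss : E → ℝ) 2 volume * lpNorm (fun x => Δ v x - h₁ x) 2 volume) +
      2 * ((∫ z : E, ‖z‖ * gauss z) * M₁ + lpNorm (fun z : E => ‖z‖ * gauss z) 2 volume *
        lpNorm (fun x => Δ v x - h₁ x) 2 volume)) * √(dist x y) := by
  have hM0 : 0 ≤ M := (abs_nonneg _).trans (hM 0)
  have hM10 : 0 ≤ M₁ := (abs_nonneg _).trans (hM₁ 0)
  have hA : 0 ≤ ∫ z : E, ‖z‖ * gauss z := integral_nonneg norm_mul_gauss_nonneg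
  rcases eq_or_ne x y with rfl | hne
  · simp
  have hpos : 0 < dist x y := dist_pos.2 hne
  have hsmall := abs_integral_le_of_abs_le_rpow_neg_half dist_nonneg
    (g := fun r => r * (gaussAvg r (Δ v) x - gaussAvg r (Δ v) y)) (d := dist x y) fun r hr => by
      have hbound := abs_mul_gaussAvg_le hd hv.laplacian hh₁ hM₁ h2 ⟨hr.1, hr.2.trans hxy⟩
      rw [mul_sub]
      refine (abs_sub _ _).trans ((add_le_add (hbound x) (hbound y)).trans_eq ?_)
      rw [← two_mul, ← mul_assoc]
  have hlarge := abs_integral_le_of_abs_le_rpow_neg_three_halves hpos hxy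
    (add_nonneg (mul_nonneg hA hM10) (mul_nonneg lpNorm_nonneg lpNorm_nonneg)) fun r hr =>
      abs_mul_gaussAvg_sub_le hd hv.laplacian hh₁ hM₁ h2 ⟨hpos.trans hr.1, hr.2⟩ x y
  have hone : |gaussAvg 1 v x - gaussAvg 1 v y| ≤ √(dist x y) * ((∫ z : E, ‖z‖ * gauss z) * M) := by
    have hmean := abs_gaussAvg_sub_le hv x y 1 fun p =>
      abs_integral_inner_mul_gauss_mul_le hM (x - y) p 1
    rw [one_mul, ← dist_eq_norm] at hmean
    refine hmean.trans ?_
    gcongr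
    exact Real.le_sqrt_of_sq_le (by nlinarith)
  have hftc := integral_mul_gaussAvg_laplacian_sub hv x y (dist x y)
  rw [abs_le] at hsmall hlarge hone ⊢
  constructor <;> linarith

variable (E) in
theorem exists_abs_sub_le_sqrt_dist_of_laplacian (hd : finrank ℝ E ≤ 3) : ∃ K, 0 ≤ K ∧
    ∀ {v h₁ : E → ℝ} {M M₁ : ℝ}, SmoothConstAtInfty v → (∀ x, |v x| ≤ M) → Continuous h₁ →
      (∀ x, |h₁ x| ≤ M₁) → MemLp (fun x => Δ v x - h₁ x) 2 → ∀ x y, dist x y ≤ 1 →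
        |v x - v y| ≤ K * (M + M₁ + lpNorm (fun x => Δ v x - h₁ x) 2 volume) * √(dist x y) := by
  set A₁ := lpNorm (gauss : E → ℝ) 2 volume
  set A₂ := ∫ z : E, ‖z‖ * gauss z
  set A₃ := lpNorm (fun z : E => ‖z‖ * gauss z) 2 volume
  have hA₁ : 0 ≤ A₁ := lpNorm_nonneg
  have hA₂ : 0 ≤ A₂ := integral_nonneg norm_mul_gauss_nonneg
  have hA₃ : 0 ≤ A₃ := lpNorm_nonneg
  refine ⟨4 + 4 * A₁ + 2 * A₂ + 2 * A₃, by positivity,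
    fun {v h₁ M M₁} hv hM hh₁ hM₁ h2 x y hxy =>
      (abs_sub_le_sqrt_dist_of_laplacian hd hv hM hh₁ hM₁ h2 hxy).trans
        (mul_le_mul_of_nonneg_right ?_ (Real.sqrt_nonneg _))⟩
  set N := lpNorm (fun x => Δ v x - h₁ x) 2 volume
  have hN : 0 ≤ N := lpNorm_nonneg
  have hM0 : 0 ≤ M := (abs_nonneg _).trans (hM 0)
  have hM10 : 0 ≤ M₁ := (abs_nonneg _).trans (hM₁ 0)
  have hA₁M : 0 ≤ A₁ * (M + M₁) := by positivity
  have hA₂M : 0 ≤ A₂ * (M + 2 * N) := by positivity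
  have hA₃M : 0 ≤ A₃ * (M + M₁) := by positivity
  linarith

end SmoothEstimates

section Kato

variable {E : Type*} [NormedAddCommGroup E] [InnerProductSpace ℝ E] [FiniteDimensional ℝ E]
  {v : E → ℝ}

theorem deriv_comp_mul_laplacian_le {g : ℝ → ℝ} (hg : ContDiff ℝ ∞ g) {x : E}
    (hconvex : 0 ≤ deriv (deriv g) (v x)) (hv : ContDiff ℝ ∞ v) :
    deriv g (v x) * Δ v x ≤ Δ (fun y => g (v y)) x := by
  have hvd (y : E) : HasFDerivAt v (fderiv ℝ v y) y :=
    (hv.differentiable (by simp) y).hasFDerivAt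
  have hg' : ContDiff ℝ ∞ (deriv g) := hg.deriv' (n := ∞)
  have hcomp {G : ℝ → ℝ} (hG : ContDiff ℝ ∞ G) (y : E) :
      HasFDerivAt (fun y => G (v y)) (deriv G (v y) • fderiv ℝ v y) y :=
    (hG.differentiable (by simp) _).hasDerivAt.comp_hasFDerivAt y (hvd y)
  let b := stdOrthonormalBasis ℝ E
  rw [laplacian_eq_sum_fderiv_fderiv b (contDiff_infty.1 hv 2),
    laplacian_eq_sum_fderiv_fderiv b (v := fun y => g (v y))
      (contDiff_infty.1 (hg.comp hv) 2), Finset.mul_sum]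
  refine Finset.sum_le_sum fun i _ => ?_
  have hfirst : (fun y => fderiv ℝ (fun y => g (v y)) y (b i)) =
      fun y => deriv g (v y) * fderiv ℝ v y (b i) := by
    ext y
    rw [(hcomp hg y).fderiv]
    rfl
  have hsecond := (hcomp hg' x).fun_mul
    ((contDiff_fderiv_apply hv (b i)).differentiable (by simp) x).hasFDerivAt
  rw [hfirst, hsecond.fderiv]
  simp only [add_apply, smul_apply, smul_eq_mul]
  nlinarith [mul_nonneg hconvex (mul_self_nonneg (fderiv ℝ v x (b i)))]

theorem hasDerivAt_sqrt_one_add_sq (t : ℝ) :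
    HasDerivAt (fun t : ℝ => √(1 + t ^ 2)) (t / √(1 + t ^ 2)) t := by
  refine ((((hasDerivAt_id t).fun_pow 2).const_add 1).sqrt (by positivity)).congr_deriv ?_
  simp only [id]
  field_simp
  norm_num

theorem hasDerivAt_div_sqrt_one_add_sq (t : ℝ) :
    HasDerivAt (fun t : ℝ => t / √(1 + t ^ 2)) (1 / √(1 + t ^ 2) ^ 3) t := by
  refine ((hasDerivAt_id t).fun_div (hasDerivAt_sqrt_one_add_sq t) (by positivity)).congr_deriv ?_
  have hsq : √(1 + t ^ 2) ^ 2 = 1 + t ^ 2 := Real.sq_sqrt (by positivity)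
  simp only [id]
  field_simp
  rw [hsq]
  ring

/-- Kato's inequality, with `√(1 + v²)` as a smooth substitute for `|v|`. -/
theorem div_sqrt_mul_laplacian_le (hv : ContDiff ℝ ∞ v) (x : E) :
    v x / √(1 + v x ^ 2) * Δ v x ≤ Δ (fun y => √(1 + v y ^ 2)) x := by
  have hfirst : deriv (fun t : ℝ => √(1 + t ^ 2)) = fun t => t / √(1 + t ^ 2) :=
    funext fun t => (hasDerivAt_sqrt_one_add_sq t).deriv
  have hsmooth : ContDiff ℝ ∞ fun t : ℝ => √(1 + t ^ 2) :=
    ContDiff.sqrt (by fun_prop) fun t => by positivity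
  have hkato := deriv_comp_mul_laplacian_le hsmooth (x := x) (v := v) (by
    rw [hfirst, (hasDerivAt_div_sqrt_one_add_sq _).deriv]
    positivity) hv
  rwa [hfirst] at hkato

theorem sqrt_one_add_sq_le_laplacian_add {f : E → ℝ} {η : ℝ} (hv : ContDiff ℝ ∞ v) {x : E}
    (hη : |Δ v x - (v x ^ 3 - v x) - f x| ≤ η) :
    √(1 + v x ^ 2) ≤ Δ (fun y => √(1 + v y ^ 2)) x + (2 + η + |f x|) := by
  have hkato := div_sqrt_mul_laplacian_le hv x
  set s := √(1 + v x ^ 2)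
  have hs1 : 1 ≤ s := Real.one_le_sqrt.2 (by nlinarith [sq_nonneg (v x)])
  have hs2 : s ^ 2 = 1 + v x ^ 2 := Real.sq_sqrt (by positivity)
  have hvs : |v x / s| ≤ 1 := by
    rw [abs_div, abs_of_pos (by linarith : 0 < s), div_le_one (by linarith)]
    exact abs_le_of_sq_le_sq (by nlinarith) (by linarith)
  have hcubic : s - v x / s * (v x ^ 3 - v x) ≤ 2 := by
    have hfactor : s - v x / s * (v x ^ 3 - v x) = (s ^ 2 - v x * (v x ^ 3 - v x)) / s := by
      field_simp
    rw [hfactor, div_le_iff₀ (by linarith), hs2]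
    nlinarith [sq_nonneg (v x ^ 2 - 1)]
  have hdefect : |v x / s * (Δ v x - (v x ^ 3 - v x))| ≤ η + |f x| := by
    have htri := abs_sub_abs_le_abs_sub (Δ v x - (v x ^ 3 - v x)) (f x)
    rw [abs_mul]
    refine (mul_le_of_le_one_left (abs_nonneg _) hvs).trans ?_
    linarith
  have hlower := (abs_le.1 hdefect).1
  rw [mul_sub] at hlower
  linarith

end Kato

section MaximumPrinciple

theorem exp_neg_half_le : Real.exp (-(1 / 2)) ≤ 2 / 3 := by
  rw [Real.exp_neg, inv_le_comm₀ (Real.exp_pos _) (by norm_num)]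
  linarith [Real.add_one_le_exp (1 / 2 : ℝ)]

theorem hasDerivAt_two_mul_sqrt {r : ℝ} (hr : 0 < r) :
    HasDerivAt (fun r => 2 * √r) (r ^ (-(1 / 2) : ℝ)) r := by
  refine ((Real.hasDerivAt_sqrt hr.ne').const_mul 2).congr_deriv ?_
  rw [Real.rpow_neg hr.le, ← Real.sqrt_eq_rpow]
  field_simp

variable {E : Type*} [NormedAddCommGroup E] [InnerProductSpace ℝ E] [FiniteDimensional ℝ E]
  [MeasurableSpace E] [BorelSpace E] {v w h : E → ℝ}

theorem hasDerivAt_exp_mul_gaussAvg (hw : SmoothConstAtInfty w) (x : E) (r : ℝ) :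
    HasDerivAt (fun r => Real.exp (-(r ^ 2 / 2)) * gaussAvg r w x)
      (r * Real.exp (-(r ^ 2 / 2)) * (gaussAvg r (Δ w) x - gaussAvg r w x)) r := by
  have hexp : HasDerivAt (fun r : ℝ => -(r ^ 2 / 2)) (-r) r :=
    (((hasDerivAt_id r).pow 2).div_const 2).neg.congr_deriv (by simp)
  exact (hexp.exp.mul (hasDerivAt_gaussAvg hw x r)).congr_deriv (by ring)

theorem le_exp_mul_gaussAvg_one_add (hd : finrank ℝ E ≤ 3) (hw : SmoothConstAtInfty w)
    (hh : Continuous h) {B : ℝ} (hB : ∀ x, |h x| ≤ B) (h2 : MemLp h 2)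
    (hle : ∀ x, w x ≤ Δ w x + h x) (x : E) :
    w x ≤ Real.exp (-(1 / 2)) * gaussAvg 1 w x +
      2 * (lpNorm (gauss : E → ℝ) 2 volume * lpNorm h 2 volume) := by
  obtain ⟨C, hC⟩ := hw.exists_abs_le
  obtain ⟨C', hC'⟩ := hw.laplacian.exists_abs_le
  set N := lpNorm (gauss : E → ℝ) 2 volume * lpNorm h 2 volume
  have havg (r : ℝ) : gaussAvg r w x ≤ gaussAvg r (Δ w) x + gaussAvg r h x := by
    rw [← gaussAvg_add hw.laplacian.continuous hC' hh hB]
    exact gaussAvg_mono hw.continuous hC (hw.laplacian.continuous.add hh)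
      (fun y => (abs_add_le _ _).trans (add_le_add (hC' y) (hB y))) hle r x
  have hmono : MonotoneOn (fun r => Real.exp (-(r ^ 2 / 2)) * gaussAvg r w x + N * (2 * √r))
      (Icc 0 1) := by
    refine monotoneOn_of_hasDerivWithinAt_nonneg (convex_Icc 0 1)
      (f' := fun r => r * Real.exp (-(r ^ 2 / 2)) * (gaussAvg r (Δ w) x - gaussAvg r w x) +
        N * r ^ (-(1 / 2) : ℝ)) ?_ (fun r hr => ?_) fun r hr => ?_
    · have := hw.continuous_gaussAvg x
      fun_prop
    · rw [interior_Icc] at hr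
      exact ((hasDerivAt_exp_mul_gaussAvg hw x r).add
        ((hasDerivAt_two_mul_sqrt hr.1).const_mul N)).hasDerivWithinAt
    · rw [interior_Icc] at hr
      have hexp : Real.exp (-(r ^ 2 / 2)) ≤ 1 := Real.exp_le_one_iff.2 (by nlinarith [sq_nonneg r])
      have hsource := mul_abs_gaussAvg_le_of_memLp hd h2 ⟨hr.1, hr.2.le⟩ x
      have hdefect : gaussAvg r w x - gaussAvg r (Δ w) x ≤ |gaussAvg r h x| :=
        (sub_le_iff_le_add'.2 (havg r)).trans (le_abs_self _)
      have hr0 := hr.1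
      have hdamped : r * Real.exp (-(r ^ 2 / 2)) * (gaussAvg r w x - gaussAvg r (Δ w) x) ≤
          r * |gaussAvg r h x| :=
        calc _ ≤ r * Real.exp (-(r ^ 2 / 2)) * |gaussAvg r h x| := by gcongr
          _ ≤ r * 1 * |gaussAvg r h x| := by gcongr
          _ = r * |gaussAvg r h x| := by rw [mul_one]
      linarith
  have hends := hmono (left_mem_Icc.2 zero_le_one) (right_mem_Icc.2 zero_le_one) zero_le_one
  norm_num [gaussAvg_zero] at hends ⊢
  linarith

theorem le_lpNorm_of_le_laplacian_add (hd : finrank ℝ E ≤ 3) (hw : SmoothConstAtInfty w)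
    (hh : Continuous h) {B : ℝ} (hB : ∀ x, |h x| ≤ B) (h2 : MemLp h 2)
    (hle : ∀ x, w x ≤ Δ w x + h x) (x : E) :
    w x ≤ 6 * (lpNorm (gauss : E → ℝ) 2 volume * lpNorm h 2 volume) := by
  obtain ⟨C, hC⟩ := hw.exists_abs_le
  have hbdd : BddAbove (range w) := ⟨C, forall_mem_range.2 fun z => (abs_le.1 (hC z)).2⟩
  have hN : 0 ≤ lpNorm (gauss : E → ℝ) 2 volume * lpNorm h 2 volume :=
    mul_nonneg lpNorm_nonneg lpNorm_nonneg
  have havg (y : E) : gaussAvg 1 w y ≤ ⨆ z, w z := by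
    simpa only [gaussAvg_const] using gaussAvg_mono hw.continuous hC continuous_const
      (fun _ => le_rfl) (fun z => le_ciSup hbdd z) 1 y
  have hsup : ⨆ z, w z ≤ Real.exp (-(1 / 2)) * (⨆ z, w z) +
      2 * (lpNorm (gauss : E → ℝ) 2 volume * lpNorm h 2 volume) :=
    ciSup_le fun y => (le_exp_mul_gaussAvg_one_add hd hw hh hB h2 hle y).trans
      (by gcongr; exact havg y)
  refine (le_ciSup hbdd x).trans ?_
  by_contra! hlt
  nlinarith [exp_neg_half_le]

theorem abs_le_of_abs_laplacian_sub_cubic_le {f : E → ℝ} {η : ℝ} (hd : finrank ℝ E ≤ 3)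
    (hv : SmoothConstAtInfty v) (hf : Continuous f) (hfc : HasCompactSupport f)
    (hη : ∀ x, |Δ v x - (v x ^ 3 - v x) - f x| ≤ η) (x : E) :
    |v x| ≤ 2 + η + 6 * (lpNorm (gauss : E → ℝ) 2 volume * lpNorm f 2 volume) := by
  have hf2 : MemLp f 2 := hf.memLp_of_hasCompactSupport hfc
  obtain ⟨B, hB⟩ := hfc.exists_bound_of_continuous hf
  have hw : SmoothConstAtInfty fun x => √(1 + v x ^ 2) :=
    hv.comp (g := fun t => √(1 + t ^ 2)) (ContDiff.sqrt (by fun_prop) fun t => by positivity)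
  have hw' : SmoothConstAtInfty fun x => √(1 + v x ^ 2) - (2 + η) :=
    hw.comp (g := fun t => t - (2 + η)) (by fun_prop)
  have hle (y : E) : √(1 + v y ^ 2) - (2 + η) ≤
      Δ (fun x => √(1 + v x ^ 2) - (2 + η)) y + |f y| := by
    rw [laplacian_sub_const (contDiff_infty.1 hw.contDiff 2)]
    linarith [sqrt_one_add_sq_le_laplacian_add hv.contDiff (hη y)]
  have hmax := le_lpNorm_of_le_laplacian_add hd hw' hf.abs (fun y => (abs_abs _).trans_le (hB y))
    hf2.abs hle x
  rw [lpNorm_fun_abs hf2.1] at hmax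
  have habs : |v x| ≤ √(1 + v x ^ 2) := Real.abs_le_sqrt (by linarith)
  linarith

end MaximumPrinciple

section Mollification

open scoped Convolution
open ContinuousLinearMap (lsmul)

section

variable {E : Type*} [NormedAddCommGroup E]

variable (E) in
/-- A smooth bump function supported in the ball of radius `2 / (k + 1)`, from which the `k`-th
mollifier is built by normalisation. -/
noncomputable def bump (k : ℕ) : ContDiffBump (0 : E) where
  rIn := 1 / ((k : ℝ) + 1)
  rOut := 2 / ((k : ℝ) + 1)
  rIn_pos := by positivity
  rIn_lt_rOut := by gcongr; norm_num

theorem bump_rOut_le_two (k : ℕ) : (bump E k).rOut ≤ 2 :=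
  div_le_self zero_le_two (by simp)

theorem tendsto_bump_rOut : Tendsto (fun k => (bump E k).rOut) atTop (𝓝 0) := by
  have h := (tendsto_one_div_add_atTop_nhds_zero_nat (𝕜 := ℝ)).const_mul 2
  rw [mul_zero] at h
  exact h.congr fun k => mul_one_div _ _

end

variable {E : Type*} [NormedAddCommGroup E] [InnerProductSpace ℝ E] [FiniteDimensional ℝ E]
  [MeasurableSpace E] [BorelSpace E] {u g : E → ℝ} {B c : ℝ} {k : ℕ} {Ω : Set E}

/-- The convolution of `u` with the `k`-th mollifier. -/
noncomputable def mollify (k : ℕ) (u : E → ℝ) : E → ℝ :=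
  (bump E k).normed volume ⋆[lsmul ℝ ℝ, volume] u

theorem mollify_apply (x : E) :
    mollify k u x = ∫ t, (bump E k).normed volume t * u (x - t) := rfl

theorem mollify_congr_ball {x : E}
    (h : ∀ᵐ y, y ∈ Metric.ball x (bump E k).rOut → u y = g y) : mollify k u x = mollify k g x := by
  rw [mollify, mollify, convolution_eq_swap, convolution_eq_swap]
  refine integral_congr_ae ?_
  filter_upwards [h] with y hy
  by_cases hyx : x - y ∈ Function.support ((bump E k).normed volume)
  · rw [ContDiffBump.support_normed_eq, mem_ball_zero_iff, ← dist_eq_norm, dist_comm] at hyx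
    rw [hy hyx]
  · rw [Function.notMem_support.1 hyx]; simp

theorem contDiff_mollify (hu : LocallyIntegrable u) : ContDiff ℝ ∞ (mollify k u) :=
  (bump E k).hasCompactSupport_normed.contDiff_convolution_left _ (bump E k).contDiff_normed hu

theorem integrable_bump_mul (hu : LocallyIntegrable u) (x : E) :
    Integrable fun t => (bump E k).normed volume t * u (x - t) :=
  ((bump E k).hasCompactSupport_normed.convolutionExists_left (lsmul ℝ ℝ)
    (bump E k).continuous_normed hu x).integrable

theorem mollify_const (x : E) : mollify k (fun _ => c) x = c := by
  simp [mollify_apply, integral_mul_const, (bump E k).integral_normed]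

theorem mollify_sub (hu : LocallyIntegrable u) (hg : LocallyIntegrable g) (x : E) :
    mollify k (fun y => u y - g y) x = mollify k u x - mollify k g x := by
  simp only [mollify_apply, mul_sub]
  exact integral_sub (integrable_bump_mul hu x) (integrable_bump_mul hg x)

theorem mollify_sub_const (hu : LocallyIntegrable u) (x : E) :
    mollify k (fun y => u y - c) x = mollify k u x - c := by
  rw [mollify_sub hu (locallyIntegrable_const c), mollify_const]

theorem abs_mollify_le_mollify_abs (x : E) : |mollify k u x| ≤ mollify k (fun y => |u y|) x := by
  refine (norm_integral_le_integral_norm fun t => (bump E k).normed volume t * u (x - t)).trans_eq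
    (integral_congr_ae (ae_of_all _ fun t => ?_))
  simp [abs_of_nonneg ((bump E k).nonneg_normed t)]

theorem abs_mollify_le (hB : ∀ᵐ x, |u x| ≤ B) (x : E) : |mollify k u x| ≤ B := by
  have hBx : ∀ᵐ t, |u (x - t)| ≤ B :=
    (quasiMeasurePreserving_sub_left_of_right_invariant volume x).ae hB
  have hle : |mollify k u x| ≤ ∫ t, (bump E k).normed volume t * B := by
    refine norm_integral_le_of_norm_le (f := fun t => (bump E k).normed volume t * u (x - t))
      ((bump E k).integrable_normed.mul_const B) (hBx.mono fun t ht => ?_)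
    rw [norm_mul, Real.norm_of_nonneg ((bump E k).nonneg_normed t)]
    exact mul_le_mul_of_nonneg_left ht ((bump E k).nonneg_normed t)
  rwa [integral_mul_const, (bump E k).integral_normed, one_mul] at hle

theorem hasCompactSupport_mollify_sub (hΩ : Bornology.IsBounded Ω)
    (huΩ : ∀ᵐ x, x ∉ Ω → u x = c) : HasCompactSupport fun x => mollify k u x - c := by
  refine HasCompactSupport.of_support_subset_isCompact
    (Metric.isCompact_of_isClosed_isBounded Metric.isClosed_cthickening (hΩ.cthickening (δ := 2)))
    fun x => not_imp_comm.1 fun hx => ?_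
  have hball : ∀ᵐ y, y ∈ Metric.ball x (bump E k).rOut → u y = c := by
    filter_upwards [huΩ] with y hy hyx
    refine hy fun hyΩ => hx (Metric.mem_cthickening_of_dist_le x y 2 Ω hyΩ ?_)
    exact (Metric.mem_ball'.1 hyx).le.trans (bump_rOut_le_two k)
  simp only [mollify_congr_ball hball, mollify_const, sub_self]

theorem smoothConstAtInfty_mollify (hu : LocallyIntegrable u) (hΩ : Bornology.IsBounded Ω)
    (huΩ : ∀ᵐ x, x ∉ Ω → u x = c) : SmoothConstAtInfty (mollify k u) :=
  ⟨contDiff_mollify hu, c, hasCompactSupport_mollify_sub hΩ huΩ⟩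

theorem ae_tendsto_mollify (hu : LocallyIntegrable u) :
    ∀ᵐ x, Tendsto (fun k => mollify k u x) atTop (𝓝 (u x)) := by
  refine ContDiffBump.ae_convolution_tendsto_right_of_locallyIntegrable (K := 2)
    tendsto_bump_rOut (Eventually.of_forall fun k => ?_) hu
  exact (mul_one_div 2 ((k : ℝ) + 1)).ge

theorem tendstoUniformly_mollify (hu : UniformContinuous u) :
    TendstoUniformly (fun k => mollify k u) u atTop := by
  refine Metric.tendstoUniformly_iff.2 fun δ hδ => ?_
  obtain ⟨η, hη, h⟩ := Metric.uniformContinuous_iff.1 hu (δ / 2) (half_pos hδ)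
  filter_upwards [(tendsto_bump_rOut (E := E)).eventually_lt_const hη] with k hk x
  rw [dist_comm]
  exact ((bump E k).dist_normed_convolution_le hu.continuous.aestronglyMeasurable
    fun y hy => (h ((Metric.mem_ball.1 hy).trans hk)).le).trans_lt (half_lt_self hδ)

theorem tendstoUniformly_mollify_comp_sub_comp_mollify {p : ℝ → ℝ} (hp : Continuous p)
    (hu : UniformContinuous u) (hB : ∀ x, |u x| ≤ B) :
    TendstoUniformly (fun k x => mollify k (fun y => p (u y)) x - p (mollify k u x)) 0 atTop := by
  have hpB : UniformContinuousOn p (Icc (-B) B) :=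
    isCompact_Icc.uniformContinuousOn_of_continuous hp.continuousOn
  have hpu : UniformContinuous fun y => p (u y) :=
    uniformContinuousOn_univ.1
      (hpB.comp hu.uniformContinuousOn fun x _ => abs_le.1 (hB x))
  have hcomp : TendstoUniformly (fun k x => p (mollify k u x)) (fun x => p (u x)) atTop :=
    hpB.comp_tendstoUniformly (fun _ x => abs_le.1 (abs_mollify_le (ae_of_all _ hB) x))
      (fun x => abs_le.1 (hB x)) (tendstoUniformly_mollify hu)
  have h := (tendstoUniformly_mollify hpu).sub hcomp
  rwa [sub_self] at h

end Mollification

section MollificationLp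

open scoped Convolution
open ContinuousLinearMap (lsmul lsmul_apply)

variable {E : Type*} [NormedAddCommGroup E] [InnerProductSpace ℝ E] [FiniteDimensional ℝ E]
  [MeasurableSpace E] [BorelSpace E] {g : E → ℝ} {k : ℕ}

theorem integrable_mollify (hg : Integrable g) : Integrable (mollify k g) :=
  (bump E k).integrable_normed.integrable_convolution (lsmul ℝ ℝ) hg

theorem integral_mollify (hg : Integrable g) : ∫ x, mollify k g x = ∫ x, g x := by
  have h := integral_convolution (μ := volume) (ν := volume) (lsmul ℝ ℝ)
    (bump E k).integrable_normed hg
  rwa [(bump E k).integral_normed, lsmul_apply, one_smul] at h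

theorem integral_abs_mollify_le (hg : Integrable g) : ∫ x, |mollify k g x| ≤ ∫ x, |g x| := by
  rw [← integral_mollify (k := k) hg.abs]
  exact integral_mono (integrable_mollify hg).abs (integrable_mollify hg.abs)
    abs_mollify_le_mollify_abs

/-- As in the Brezis–Lieb lemma, `|g_k - g| - |g_k|` is dominated by `|g|`, so its integral
converges; the remaining term `∫ |g_k|` is at most `∫ |g|`. -/
theorem tendsto_integral_abs_mollify_sub (hg : Integrable g) :
    Tendsto (fun k => ∫ x, |mollify k g x - g x|) atTop (𝓝 0) := by
  have hdiff (k : ℕ) : Integrable fun x => |mollify k g x - g x| :=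
    ((integrable_mollify hg).sub hg).abs
  have hlim : Tendsto (fun k => ∫ x, (|mollify k g x - g x| - |mollify k g x|)) atTop
      (𝓝 (∫ x, (0 - |g x|))) := by
    refine tendsto_integral_of_dominated_convergence (fun x => |g x|)
      (fun k => ((hdiff k).sub (integrable_mollify hg).abs).1) hg.abs
      (fun k => ae_of_all _ fun x => ?_) ?_
    · simpa [abs_sub_comm] using abs_abs_sub_abs_le_abs_sub (mollify k g x - g x) (mollify k g x)
    · filter_upwards [ae_tendsto_mollify hg.locallyIntegrable] with x hx
      simpa using (hx.sub_const (g x)).abs.sub hx.abs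
  have hbound : Tendsto (fun k => (∫ x, (|mollify k g x - g x| - |mollify k g x|)) + ∫ x, |g x|)
      atTop (𝓝 0) := by
    simpa [integral_neg] using hlim.add_const (∫ x, |g x|)
  refine squeeze_zero (fun k => integral_nonneg fun x => abs_nonneg _) (fun k => ?_) hbound
  rw [integral_sub (hdiff k) (integrable_mollify hg).abs]
  linarith [integral_abs_mollify_le (k := k) hg]

theorem tendsto_setIntegral_abs_mollify_sub (hg : LocallyIntegrable g) {K : Set E}
    (hK : IsCompact K) : Tendsto (fun k => ∫ x in K, |mollify k g x - g x|) atTop (𝓝 0) := by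
  have hK' : IsCompact (Metric.cthickening 2 K) := hK.cthickening
  set g' : E → ℝ := (Metric.cthickening 2 K).indicator g
  have hg' : Integrable g' :=
    (hg.integrableOn_isCompact hK').integrable_indicator hK'.isClosed.measurableSet
  have heq (k : ℕ) : ∀ x ∈ K, |mollify k g x - g x| = |mollify k g' x - g' x| := by
    intro x hx
    have hgx {y : E} (hy : dist y x ≤ 2) : g y = g' y :=
      (indicator_of_mem (Metric.mem_cthickening_of_dist_le y x 2 K hx hy) g).symm
    rw [hgx (y := x) (by simp), mollify_congr_ball (k := k) (g := g')]
    exact ae_of_all _ fun y hy => hgx ((Metric.mem_ball.1 hy).le.trans (bump_rOut_le_two k))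
  refine squeeze_zero (fun k => integral_nonneg fun x => abs_nonneg _) (fun k => ?_)
    (tendsto_integral_abs_mollify_sub hg')
  rw [setIntegral_congr_fun hK.isClosed.measurableSet (heq k)]
  exact setIntegral_le_integral ((integrable_mollify hg').sub hg').abs
    (ae_of_all _ fun x => abs_nonneg _)

theorem mollify_sq_le_mollify_sq (hg : LocallyIntegrable g)
    (hg2 : LocallyIntegrable fun x => g x ^ 2) (x : E) :
    mollify k g x ^ 2 ≤ mollify k (fun y => g y ^ 2) x := by
  set m := mollify k g x with hm
  have hint := integrable_bump_mul (k := k) hg x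
  have hint2 := integrable_bump_mul (k := k) hg2 x
  have hvar : 0 ≤ ∫ t, (bump E k).normed volume t * (g (x - t) - m) ^ 2 :=
    integral_nonneg fun t => mul_nonneg ((bump E k).nonneg_normed t) (sq_nonneg _)
  have hexpand (t : E) : (bump E k).normed volume t * (g (x - t) - m) ^ 2 =
      (bump E k).normed volume t * g (x - t) ^ 2 -
        2 * m * ((bump E k).normed volume t * g (x - t)) +
        m ^ 2 * (bump E k).normed volume t := by ring
  simp_rw [hexpand] at hvar
  have hint12 : Integrable fun t => (bump E k).normed volume t * g (x - t) ^ 2 -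
      2 * m * ((bump E k).normed volume t * g (x - t)) := hint2.sub (hint.const_mul _)
  rw [integral_add hint12 ((bump E k).integrable_normed.const_mul _),
    integral_sub hint2 (hint.const_mul _), integral_const_mul, integral_const_mul,
    (bump E k).integral_normed, ← mollify_apply (u := g), ← mollify_apply (u := fun y => g y ^ 2),
    ← hm] at hvar
  linarith

theorem memLp_mollify (hg : MemLp g 2) : MemLp (mollify k g) 2 := by
  have hgl := hg.locallyIntegrable one_le_two
  have hmeas : AEStronglyMeasurable (mollify k g) :=
    (contDiff_mollify (k := k) hgl).continuous.aestronglyMeasurable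
  refine (memLp_two_iff_integrable_sq hmeas).2
    ((integrable_mollify (k := k) hg.integrable_sq).mono' (hmeas.pow 2) (ae_of_all _ fun x => ?_))
  rw [Real.norm_of_nonneg (sq_nonneg _)]
  exact mollify_sq_le_mollify_sq hgl hg.integrable_sq.locallyIntegrable x

theorem lpNorm_mollify_le (hg : MemLp g 2) : lpNorm (mollify k g) 2 volume ≤ lpNorm g 2 volume := by
  have hsq {h : E → ℝ} (hh : MemLp h 2) : lpNorm h 2 volume = √(∫ x, h x ^ 2) := by
    rw [lpNorm_eq_integral_norm_rpow_toReal two_ne_zero ENNReal.ofNat_ne_top hh.1]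
    simp [Real.sqrt_eq_rpow]
  rw [hsq (memLp_mollify hg), hsq hg, ← integral_mollify (k := k) hg.integrable_sq]
  exact Real.sqrt_le_sqrt (integral_mono (memLp_mollify hg).integrable_sq
    (integrable_mollify hg.integrable_sq) (mollify_sq_le_mollify_sq
      (hg.locallyIntegrable one_le_two) hg.integrable_sq.locallyIntegrable))

end MollificationLp

section WeakLaplacian

open scoped Convolution
open ContinuousLinearMap (lsmul)

variable {E : Type*} [NormedAddCommGroup E] [InnerProductSpace ℝ E] [FiniteDimensional ℝ E]

theorem laplacian_comp_add_smul {v : E → ℝ} (hv : ContDiff ℝ 2 v) (a : E) (r : ℝ) (x : E) :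
    Δ (fun z => v (a + r • z)) x = r ^ 2 * Δ v (a + r • x) := by
  have hfd (w : E → ℝ) (e x : E) :
      fderiv ℝ (fun z => w (a + r • z)) x e = r * fderiv ℝ w (a + r • x) e := by
    rw [fderiv_comp_smul (f := fun z => w (a + z)), fderiv_comp_add_left]; rfl
  set b := stdOrthonormalBasis ℝ E
  have hv' : ContDiff ℝ 2 fun z => v (a + r • z) :=
    hv.comp (contDiff_const.add (contDiff_const_smul r))
  rw [laplacian_eq_sum_fderiv_fderiv b hv', laplacian_eq_sum_fderiv_fderiv b hv, Finset.mul_sum]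
  refine Finset.sum_congr rfl fun i _ => ?_
  have hdiff : Differentiable ℝ fun y => fderiv ℝ v y (b i) :=
    ((hv.fderiv_right (m := 1) le_rfl).clm_apply contDiff_const).differentiable one_ne_zero
  simp_rw [hfd v]
  rw [hfd (fun y => r * fderiv ℝ v y (b i)), fderiv_const_mul (hdiff _)]
  simp only [smul_apply, smul_eq_mul]
  ring

variable [MeasurableSpace E] [BorelSpace E] {u F ψ : E → ℝ}

/-- The function `u` is locally integrable and its distributional Laplacian is the locally
integrable function `F`. -/
structure HasWeakLaplacian (u F : E → ℝ) : Prop where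
  locallyIntegrable : LocallyIntegrable u
  locallyIntegrable_laplacian : LocallyIntegrable F
  integral_mul_laplacian : ∀ φ : E → ℝ, ContDiff ℝ ∞ φ → HasCompactSupport φ →
    ∫ x, u x * Δ φ x = ∫ x, F x * φ x

theorem fderiv_convolution_apply (hψ : ContDiff ℝ 1 ψ) (hψc : HasCompactSupport ψ)
    (hu : LocallyIntegrable u) (x e : E) :
    fderiv ℝ (ψ ⋆[lsmul ℝ ℝ, volume] u) x e =
      ((fun t => fderiv ℝ ψ t e) ⋆[lsmul ℝ ℝ, volume] u) x := by
  have hex := ((hψc.fderiv ℝ).convolutionExists_left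
    (ContinuousLinearMap.precompL E (lsmul ℝ ℝ : ℝ →L[ℝ] ℝ →L[ℝ] ℝ))
    (hψ.continuous_fderiv one_ne_zero) hu x).integrable
  rw [(hψc.hasFDerivAt_convolution_left (lsmul ℝ ℝ) hψ hu x).fderiv, convolution_def,
    ContinuousLinearMap.integral_apply hex]
  rfl

theorem laplacian_convolution (hψ : ContDiff ℝ ∞ ψ) (hψc : HasCompactSupport ψ)
    (hu : LocallyIntegrable u) (x : E) :
    Δ (ψ ⋆[lsmul ℝ ℝ, volume] u) x = (Δ ψ ⋆[lsmul ℝ ℝ, volume] u) x := by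
  set b := stdOrthonormalBasis ℝ E
  have hψ' (e : E) : ContDiff ℝ ∞ fun t => fderiv ℝ ψ t e := contDiff_fderiv_apply hψ e
  have hψc' (e : E) : HasCompactSupport fun t => fderiv ℝ ψ t e := hψc.fderiv_apply ℝ e
  have hψ'' (e : E) : ContDiff ℝ ∞ fun t => fderiv ℝ (fun s => fderiv ℝ ψ s e) t e :=
    contDiff_fderiv_apply (hψ' e) e
  have hint (e : E) : Integrable fun t => fderiv ℝ (fun s => fderiv ℝ ψ s e) t e * u (x - t) :=
    (((hψc' e).fderiv_apply ℝ e).convolutionExists_left (lsmul ℝ ℝ)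
      (hψ'' e).continuous hu x).integrable
  have hsmooth : ContDiff ℝ 2 (ψ ⋆[lsmul ℝ ℝ, volume] u) :=
    contDiff_infty.1 (hψc.contDiff_convolution_left _ hψ hu) 2
  calc Δ (ψ ⋆[lsmul ℝ ℝ, volume] u) x
      = ∑ i, ∫ t, fderiv ℝ (fun s => fderiv ℝ ψ s (b i)) t (b i) * u (x - t) := by
        rw [laplacian_eq_sum_fderiv_fderiv b hsmooth]
        refine Finset.sum_congr rfl fun i _ => ?_
        simp_rw [fderiv_convolution_apply (contDiff_infty.1 hψ 1) hψc hu]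
        rw [fderiv_convolution_apply (contDiff_infty.1 (hψ' _) 1) (hψc' _) hu]
        rfl
    _ = (Δ ψ ⋆[lsmul ℝ ℝ, volume] u) x := by
        rw [← integral_finsetSum _ fun i _ => hint (b i), convolution_def]
        refine integral_congr_ae (ae_of_all _ fun t => ?_)
        simp only [laplacian_eq_sum_fderiv_fderiv b (contDiff_infty.1 hψ 2), Finset.sum_mul,
          ContinuousLinearMap.lsmul_apply, smul_eq_mul]

theorem HasWeakLaplacian.laplacian_mollify (h : HasWeakLaplacian u F) (k : ℕ) (x : E) :
    Δ (mollify k u) x = mollify k F x := by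
  set ρ : E → ℝ := (bump E k).normed volume
  have hρd : ContDiff ℝ ∞ ρ := (bump E k).contDiff_normed
  have hρc : HasCompactSupport ρ := (bump E k).hasCompactSupport_normed
  have hφd : ContDiff ℝ ∞ fun y => ρ (x - y) := hρd.comp (contDiff_const.sub contDiff_id)
  have hφc : HasCompactSupport fun y => ρ (x - y) := hρc.comp_homeomorph (Homeomorph.subLeft x)
  have hΔ (y : E) : Δ (fun y => ρ (x - y)) y = Δ ρ (x - y) := by
    simpa [← sub_eq_add_neg] using laplacian_comp_add_smul (contDiff_infty.1 hρd 2) x (-1) y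
  have hweak := h.integral_mul_laplacian _ hφd hφc
  rw [mollify, mollify, laplacian_convolution hρd hρc h.locallyIntegrable, convolution_eq_swap,
    convolution_eq_swap]
  simpa only [ContinuousLinearMap.lsmul_apply, smul_eq_mul, mul_comm, hΔ] using hweak

theorem locallyIntegrable_comp_smul (hu : LocallyIntegrable u) {r : ℝ} (hr : r ≠ 0) :
    LocallyIntegrable fun x => u (r • x) := by
  refine (locallyIntegrable_map_homeomorph (Homeomorph.smulOfNeZero r hr)).1 fun x => ?_
  obtain ⟨U, hU, h⟩ := hu x
  refine ⟨U, hU, ?_⟩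
  rw [IntegrableOn, show Measure.map (Homeomorph.smulOfNeZero r hr) volume = _ from
    Measure.map_addHaar_smul volume hr, Measure.restrict_smul]
  exact Integrable.smul_measure h ENNReal.ofReal_ne_top

theorem HasWeakLaplacian.comp_smul (h : HasWeakLaplacian u F) {r : ℝ} (hr : r ≠ 0) :
    HasWeakLaplacian (fun x => u (r • x)) fun x => r ^ 2 * F (r • x) where
  locallyIntegrable := locallyIntegrable_comp_smul h.locallyIntegrable hr
  locallyIntegrable_laplacian :=
    (locallyIntegrable_comp_smul h.locallyIntegrable_laplacian hr).smul (r ^ 2)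
  integral_mul_laplacian φ hφ hφc := by
    set χ : E → ℝ := fun y => φ (r⁻¹ • y) with hχ
    have hχφ (x : E) : φ x = χ (r • x) := by simp only [hχ, inv_smul_smul₀ hr]
    have hΔ (x : E) : Δ φ x = r ^ 2 * Δ χ (r • x) := by
      have h0 := laplacian_comp_add_smul (contDiff_infty.1 hφ 2) 0 r⁻¹ (r • x)
      simp only [zero_add, inv_smul_smul₀ hr] at h0
      rw [h0, ← mul_assoc, ← mul_pow, mul_inv_cancel₀ hr, one_pow, one_mul]
    have hweak := h.integral_mul_laplacian χ (hφ.comp (contDiff_const_smul _))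
      (hφc.comp_smul (inv_ne_zero hr))
    simp_rw [hΔ, hχφ, mul_left_comm _ (r ^ 2), mul_assoc, integral_const_mul]
    rw [Measure.integral_comp_smul volume (fun y => u y * Δ χ y),
      Measure.integral_comp_smul volume (fun y => F y * χ y), hweak]

end WeakLaplacian

section EquicontinuousLimit

theorem exists_ae_eq_forall_tendsto_of_equicontinuous {X : Type*} [TopologicalSpace X]
    [MeasurableSpace X] {μ : Measure X} [μ.IsOpenPosMeasure] {v : ℕ → X → ℝ} {u : X → ℝ}
    (hv : Equicontinuous v) (hlim : ∀ᵐ x ∂μ, Tendsto (fun k => v k x) atTop (𝓝 (u x))) :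
    ∃ w : X → ℝ, u =ᵐ[μ] w ∧ ∀ x, Tendsto (fun k => v k x) atTop (𝓝 (w x)) := by
  have hcauchy (x : X) : CauchySeq fun k => v k x := by
    refine Metric.cauchySeq_iff.2 fun δ hδ => ?_
    obtain ⟨y, hyx, hy⟩ := (Measure.dense_of_ae hlim).exists_mem_open isOpen_interior
      ⟨x, mem_interior_iff_mem_nhds.2 (Metric.equicontinuousAt_iff_right.1 (hv x) (δ / 3)
        (by positivity))⟩
    obtain ⟨N, hN⟩ := Metric.cauchySeq_iff.1 hyx.cauchySeq (δ / 3) (by positivity)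
    have hclose : ∀ k, dist (v k x) (v k y) < δ / 3 := interior_subset hy
    refine ⟨N, fun i hi j hj => ?_⟩
    calc dist (v i x) (v j x)
        ≤ dist (v i x) (v i y) + dist (v i y) (v j y) + dist (v j y) (v j x) :=
          dist_triangle4 _ _ _ _
      _ < δ / 3 + δ / 3 + δ / 3 :=
          add_lt_add (add_lt_add (hclose i) (hN i hi j hj)) (dist_comm (v j x) _ ▸ hclose j)
      _ = δ := by ring
  choose w hw using fun x => cauchySeq_tendsto_of_complete (hcauchy x)
  exact ⟨w, hlim.mono fun x hx => tendsto_nhds_unique hx (hw x), hw⟩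

variable {X : Type*} [PseudoMetricSpace X] {L : ℝ}

theorem tendsto_mul_sqrt_dist (L : ℝ) (x : X) :
    Tendsto (fun y => L * √(dist x y)) (𝓝 x) (𝓝 0) := by
  have hcont : Continuous fun y => L * √(dist x y) := by fun_prop
  simpa using hcont.tendsto x

theorem equicontinuous_of_abs_sub_le_sqrt_dist {ι : Type*} {v : ι → X → ℝ}
    (hv : ∀ i x y, dist x y ≤ 1 → |v i x - v i y| ≤ L * √(dist x y)) : Equicontinuous v := by
  refine fun x => Metric.equicontinuousAt_of_continuity_modulus _ (tendsto_mul_sqrt_dist L x) v ?_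
  filter_upwards [Metric.closedBall_mem_nhds x one_pos] with y hy i
  exact hv i x y (Metric.mem_closedBall'.1 hy)

theorem uniformContinuous_of_abs_sub_le_sqrt_dist {w : X → ℝ}
    (hw : ∀ x y, dist x y ≤ 1 → |w x - w y| ≤ L * √(dist x y)) : UniformContinuous w := by
  have hmod : Tendsto (fun t : ℝ => L * √t) (𝓝 0) (𝓝 0) := by
    have hcont : Continuous fun t : ℝ => L * √t := by fun_prop
    simpa using hcont.tendsto 0
  refine Metric.uniformContinuous_iff.2 fun δ hδ => ?_
  obtain ⟨η, hη, h⟩ := Metric.eventually_nhds_iff.1 (hmod.eventually_lt_const hδ)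
  refine ⟨min η 1, lt_min hη one_pos, fun x y hxy => ?_⟩
  refine (hw x y (hxy.le.trans (min_le_right _ _))).trans_lt (h ?_)
  simpa using hxy.trans_le (min_le_left _ _)

end EquicontinuousLimit

section WeakEstimates

variable {E : Type*} [NormedAddCommGroup E] [InnerProductSpace ℝ E] [FiniteDimensional ℝ E]
  [MeasurableSpace E] [BorelSpace E] {u w F : E → ℝ} {Ω : Set E} {c B : ℝ}

theorem ae_abs_sub_le_of_memLp_laplacian (hd : finrank ℝ E ≤ 3) (h : HasWeakLaplacian u F)
    (hΩ : Bornology.IsBounded Ω) (huΩ : ∀ᵐ x, x ∉ Ω → u x = c) (hu : MemLp (fun x => u x - c) 2)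
    (hF : MemLp F 2) :
    ∀ᵐ x, |u x - c| ≤ lpNorm (gauss : E → ℝ) 2 volume *
      (lpNorm (fun x => u x - c) 2 volume + 2 * lpNorm F 2 volume) := by
  have hsub (k : ℕ) : mollify k (fun x => u x - c) = fun x => mollify k u x - c :=
    funext fun x => mollify_sub_const h.locallyIntegrable x
  have hΔ (k : ℕ) : Δ (mollify k fun x => u x - c) = mollify k F := by
    rw [hsub, laplacian_sub_const (contDiff_infty.1 (contDiff_mollify h.locallyIntegrable) 2)]
    exact funext (h.laplacian_mollify k)
  have hbound (k : ℕ) (x : E) : |mollify k u x - c| ≤ lpNorm (gauss : E → ℝ) 2 volume *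
      (lpNorm (fun x => u x - c) 2 volume + 2 * lpNorm F 2 volume) := by
    have hv : SmoothConstAtInfty (mollify k fun x => u x - c) :=
      smoothConstAtInfty_mollify (c := 0) (hu.locallyIntegrable one_le_two) hΩ
        (huΩ.mono fun x hx hxΩ => sub_eq_zero.2 (hx hxΩ))
    have hle := abs_le_lpNorm_add_lpNorm_laplacian hd hv (memLp_mollify hu) x
    rw [hΔ, congrFun (hsub k) x] at hle
    refine hle.trans ?_
    gcongr
    exacts [lpNorm_nonneg, lpNorm_mollify_le hu, lpNorm_mollify_le hF]
  filter_upwards [ae_tendsto_mollify h.locallyIntegrable] with x hx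
  exact le_of_tendsto' (hx.sub_const c).abs fun k => hbound k x

theorem exists_holder_representative (E : Type*) [NormedAddCommGroup E] [InnerProductSpace ℝ E]
    [FiniteDimensional ℝ E] [MeasurableSpace E] [BorelSpace E] (hd : finrank ℝ E ≤ 3) :
    ∃ K : ℝ, 0 ≤ K ∧ ∀ {u F h₁ : E → ℝ} {Ω : Set E} {c M M₁ : ℝ}, HasWeakLaplacian u F →
      Bornology.IsBounded Ω → (∀ᵐ x, x ∉ Ω → u x = c) → (∀ᵐ x, |u x| ≤ M) →
      (∀ᵐ x, |h₁ x| ≤ M₁) → MemLp (fun x => F x - h₁ x) 2 →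
      ∃ w : E → ℝ, u =ᵐ[volume] w ∧ (∀ x, |w x| ≤ M) ∧ ∀ x y, dist x y ≤ 1 →
        |w x - w y| ≤ K * (M + M₁ + lpNorm (fun x => F x - h₁ x) 2 volume) * √(dist x y) := by
  obtain ⟨K, hK, hholder⟩ := exists_abs_sub_le_sqrt_dist_of_laplacian E hd
  refine ⟨K, hK, fun {u F h₁ Ω c M M₁} h hΩ huΩ hM hM₁ hf => ?_⟩
  have hh₁ : LocallyIntegrable h₁ := by
    simpa [Pi.sub_def] using h.locallyIntegrable_laplacian.sub (hf.locallyIntegrable one_le_two)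
  have hdiff (k : ℕ) : (fun x => Δ (mollify k u) x - mollify k h₁ x) =
      mollify k fun x => F x - h₁ x := by
    ext x
    rw [h.laplacian_mollify, mollify_sub h.locallyIntegrable_laplacian hh₁]
  have hmoll (k : ℕ) (x y : E) (hxy : dist x y ≤ 1) : |mollify k u x - mollify k u y| ≤
      K * (M + M₁ + lpNorm (fun x => F x - h₁ x) 2 volume) * √(dist x y) := by
    have hle := hholder (smoothConstAtInfty_mollify (k := k) h.locallyIntegrable hΩ huΩ)
      (abs_mollify_le hM) (contDiff_mollify (k := k) hh₁).continuous (abs_mollify_le hM₁)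
      (by rw [hdiff]; exact memLp_mollify hf) x y hxy
    rw [hdiff] at hle
    refine hle.trans ?_
    gcongr
    exact lpNorm_mollify_le hf
  obtain ⟨w, huw, hw⟩ := exists_ae_eq_forall_tendsto_of_equicontinuous
    (equicontinuous_of_abs_sub_le_sqrt_dist hmoll) (ae_tendsto_mollify h.locallyIntegrable)
  exact ⟨w, huw, fun x => le_of_tendsto' (hw x).abs fun k => abs_mollify_le hM x,
    fun x y hxy => le_of_tendsto' ((hw x).sub (hw y)).abs fun k => hmoll k x y hxy⟩

theorem exists_uniformContinuous_representative (hd : finrank ℝ E ≤ 3) (h : HasWeakLaplacian u F)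
    (hΩ : Bornology.IsBounded Ω) (huΩ : ∀ᵐ x, x ∉ Ω → u x = c) (hu : MemLp (fun x => u x - c) 2)
    (hF : MemLp F 2) :
    ∃ w : E → ℝ, u =ᵐ[volume] w ∧ UniformContinuous w ∧ ∃ B, ∀ x, |w x| ≤ B := by
  obtain ⟨K, -, hK⟩ := exists_holder_representative E hd
  have hbound : ∀ᵐ x, |u x| ≤ lpNorm (gauss : E → ℝ) 2 volume *
      (lpNorm (fun x => u x - c) 2 volume + 2 * lpNorm F 2 volume) + |c| := by
    filter_upwards [ae_abs_sub_le_of_memLp_laplacian hd h hΩ huΩ hu hF] with x hx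
    linarith [abs_sub_abs_le_abs_sub (u x) c]
  obtain ⟨w, huw, hwB, hwL⟩ := hK (h₁ := fun _ => 0) (M₁ := 0) h hΩ huΩ hbound (by simp)
    (by simpa using hF)
  exact ⟨w, huw, uniformContinuous_of_abs_sub_le_sqrt_dist hwL, _, hwB⟩

theorem HasWeakLaplacian.congr_left (h : HasWeakLaplacian u F) (huw : u =ᵐ[volume] w) :
    HasWeakLaplacian w F where
  locallyIntegrable := h.locallyIntegrable.congr huw
  locallyIntegrable_laplacian := h.locallyIntegrable_laplacian
  integral_mul_laplacian φ hφ hφc := by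
    rw [← h.integral_mul_laplacian φ hφ hφc]
    exact integral_congr_ae (huw.mono fun x hx => by simp only [hx])

theorem abs_le_of_hasWeakLaplacian_cubic (hd : finrank ℝ E ≤ 3) (h : HasWeakLaplacian w F)
    (hΩ : Bornology.IsBounded Ω) (hc : c ^ 3 = c) (hwΩ : ∀ᵐ x, x ∉ Ω → w x = c)
    (hw : UniformContinuous w) (hB : ∀ x, |w x| ≤ B)
    (hf : MemLp (fun x => F x - (w x ^ 3 - w x)) 2) (x : E) :
    |w x| ≤ 3 + 6 * (lpNorm (gauss : E → ℝ) 2 volume *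
      lpNorm (fun x => F x - (w x ^ 3 - w x)) 2 volume) := by
  have hw0 := h.locallyIntegrable
  set p : E → ℝ := fun x => w x ^ 3 - w x with hp_def
  have hp : LocallyIntegrable p :=
    ((hw.continuous.pow 3).sub hw.continuous).locallyIntegrable
  have hv (k : ℕ) : SmoothConstAtInfty (mollify k w) := smoothConstAtInfty_mollify hw0 hΩ hwΩ
  have hfk (k : ℕ) (x : E) : mollify k (fun x => F x - p x) x =
      Δ (mollify k w) x - mollify k p x := by
    rw [h.laplacian_mollify, mollify_sub h.locallyIntegrable_laplacian hp]
  have hfc (k : ℕ) : HasCompactSupport (mollify k fun x => F x - p x) := by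
    have hpc : HasCompactSupport fun x => mollify k p x - 0 := by
      refine hasCompactSupport_mollify_sub hΩ (hwΩ.mono fun x hx hxΩ => ?_)
      simp only [hp_def, hx hxΩ, hc, sub_self]
    simp only [sub_zero] at hpc
    rw [show (mollify k fun x => F x - p x) = Δ (mollify k w) - mollify k p from funext (hfk k)]
    exact (hv k).hasCompactSupport_laplacian.sub hpc
  have hunif := tendstoUniformly_mollify_comp_sub_comp_mollify
    (p := fun t => t ^ 3 - t) (by fun_prop) hw hB
  refine le_of_tendsto ((tendstoUniformly_mollify hw).tendsto_at x).abs ?_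
  filter_upwards [Metric.tendstoUniformly_iff.1 hunif 1 one_pos] with k hk
  have hη (y : E) : |Δ (mollify k w) y - (mollify k w y ^ 3 - mollify k w y) -
      mollify k (fun x => F x - p x) y| ≤ 1 := by
    have hky := (hk y).le
    rw [Pi.zero_apply, dist_zero_left] at hky
    rw [hfk]
    refine (congrArg abs ?_).trans_le hky
    simp only [hp_def]
    ring
  have hle := abs_le_of_abs_laplacian_sub_cubic_le hd (hv k)
    (contDiff_mollify (k := k) (hf.locallyIntegrable one_le_two)).continuous (hfc k) hη x
  norm_num only at hle
  refine hle.trans ?_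
  gcongr
  exacts [lpNorm_nonneg, lpNorm_mollify_le hf]

end WeakEstimates

section CubicEstimate

variable (E : Type*) [NormedAddCommGroup E] [InnerProductSpace ℝ E] [FiniteDimensional ℝ E]
  [MeasurableSpace E] [BorelSpace E]

theorem exists_bounded_holder_representative_of_cubic (hd : finrank ℝ E ≤ 3) (A : ℝ) :
    ∃ C : ℝ, 0 ≤ C ∧ ∀ {u F : E → ℝ} {Ω : Set E} {c : ℝ}, HasWeakLaplacian u F →
      Bornology.IsBounded Ω → c ^ 3 = c → (∀ᵐ x, x ∉ Ω → u x = c) →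
      MemLp (fun x => u x - c) 2 → MemLp F 2 → MemLp (fun x => F x - (u x ^ 3 - u x)) 2 →
      lpNorm (fun x => F x - (u x ^ 3 - u x)) 2 volume ≤ A →
      ∃ w : E → ℝ, u =ᵐ[volume] w ∧ (∀ x, |w x| ≤ C) ∧
        ∀ x y, dist x y ≤ 1 → |w x - w y| ≤ C * √(dist x y) := by
  obtain ⟨K, hK, hholder⟩ := exists_holder_representative E hd
  set M := 3 + 6 * (lpNorm (gauss : E → ℝ) 2 volume * A) with hM
  set L := K * (M + (M ^ 3 + M) + A)
  refine ⟨max 0 (max M L), le_max_left _ _, fun {u F Ω c} h hΩ hc huΩ hu hF hf hA => ?_⟩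
  obtain ⟨v, huv, hv, B, hB⟩ := exists_uniformContinuous_representative hd h hΩ huΩ hu hF
  have hfv : (fun x => F x - (u x ^ 3 - u x)) =ᵐ[volume] fun x => F x - (v x ^ 3 - v x) :=
    huv.mono fun x hx => by simp only [hx]
  have hvΩ : ∀ᵐ x, x ∉ Ω → v x = c := by
    filter_upwards [huv, huΩ] with x hx hxΩ
    rwa [← hx]
  have hvM (x : E) : |v x| ≤ M := by
    refine (abs_le_of_hasWeakLaplacian_cubic hd (h.congr_left huv) hΩ hc hvΩ hv hB
      (hf.ae_eq hfv) x).trans ?_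
    rw [← toReal_eLpNorm (hf.ae_eq hfv).1, ← eLpNorm_congr_ae hfv, toReal_eLpNorm hf.1, hM]
    gcongr
    exact lpNorm_nonneg
  have huM : ∀ᵐ x, |u x| ≤ M := huv.mono fun x hx => hx ▸ hvM x
  have hcubic : ∀ᵐ x, |u x ^ 3 - u x| ≤ M ^ 3 + M := by
    filter_upwards [huM] with x hx
    refine (abs_sub _ _).trans (add_le_add ?_ hx)
    rw [abs_pow]
    gcongr
  obtain ⟨w, huw, hwM, hwL⟩ := hholder h hΩ huΩ huM hcubic hf
  refine ⟨w, huw, fun x => (hwM x).trans (by simp), fun x y hxy => (hwL x y hxy).trans ?_⟩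
  gcongr
  exact le_max_of_le_right (le_max_of_le_right
    (mul_le_mul_of_nonneg_left (add_le_add_right hA _) hK))

variable {E}

theorem eLpNorm_two_le_of_lintegral_sq_le {h : E → ℝ} {A : ℝ} (hA : 0 ≤ A)
    (hh : ∫⁻ x, ENNReal.ofReal (h x ^ 2) ≤ ENNReal.ofReal (A ^ 2)) :
    eLpNorm h 2 volume ≤ ENNReal.ofReal A := by
  have hsq : ∫⁻ x, ‖h x‖ₑ ^ (2 : ℝ) = ∫⁻ x, ENNReal.ofReal (h x ^ 2) := by
    refine lintegral_congr fun x => ?_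
    rw [Real.enorm_eq_ofReal_abs, ENNReal.ofReal_rpow_of_nonneg (abs_nonneg _) zero_le_two,
      Real.rpow_two, sq_abs]
  rw [eLpNorm_eq_lintegral_rpow_enorm_toReal two_ne_zero ENNReal.ofNat_ne_top,
    ENNReal.toReal_ofNat, hsq, one_div, ENNReal.rpow_inv_le_iff two_pos,
    ENNReal.ofReal_rpow_of_nonneg hA zero_le_two, Real.rpow_two]
  exact hh

/-- At scale `ε` the energy density `ε⁻¹ (ε F - ε⁻¹ (u ^ 3 - u)) ^ 2` is `ε⁻³` times the square
of the unscaled expression; the Jacobian `ε⁻ᵈ` of the dilation absorbs this when `d ≤ 3`. -/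
theorem lintegral_rescaled_sq_le (hd : finrank ℝ E ≤ 3) (u F : E → ℝ) {ε : ℝ} (hε : 0 < ε)
    (hε1 : ε ≤ 1) :
    ∫⁻ x, ENNReal.ofReal ((ε ^ 2 * F (ε • x) - (u (ε • x) ^ 3 - u (ε • x))) ^ 2) ≤
      ∫⁻ x, ENNReal.ofReal (1 / ε * (ε * F x - 1 / ε * (u x ^ 3 - u x)) ^ 2) := by
  set e : E → ℝ := fun x => 1 / ε * (ε * F x - 1 / ε * (u x ^ 3 - u x)) ^ 2
  have hscale (x : E) : ENNReal.ofReal ((ε ^ 2 * F (ε • x) - (u (ε • x) ^ 3 - u (ε • x))) ^ 2) =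
      ENNReal.ofReal (ε ^ 3) * ENNReal.ofReal (e (0 + ε • x)) := by
    rw [← ENNReal.ofReal_mul (by positivity), zero_add]
    congr 1
    simp only [e]
    field_simp
  simp_rw [hscale]
  rw [lintegral_const_mul' _ _ ENNReal.ofReal_ne_top,
    lintegral_comp_add_smul (fun x => ENNReal.ofReal (e x)) hε.ne' 0, ← mul_assoc,
    ← ENNReal.ofReal_mul (by positivity), abs_of_pos (by positivity)]
  refine mul_le_of_le_one_left zero_le (ENNReal.ofReal_le_one.2 ?_)
  rw [mul_inv_le_iff₀ (by positivity), one_mul]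
  exact pow_le_pow_of_le_one hε.le hε1 hd

theorem exists_bounded_holder_representative_of_rescaled_cubic (hd : finrank ℝ E ≤ 3) {A : ℝ}
    (hA : 0 ≤ A) :
    ∃ C : ℝ, 0 ≤ C ∧ ∀ {ε : ℝ} {u F : E → ℝ} {Ω : Set E} {c : ℝ}, 0 < ε → ε ≤ 1 →
      HasWeakLaplacian u F → Bornology.IsBounded Ω → c ^ 3 = c → (∀ᵐ x, x ∉ Ω → u x = c) →
      MemLp (fun x => u x - c) 2 → MemLp F 2 →
      ∫⁻ x, ENNReal.ofReal (1 / ε * (ε * F x - 1 / ε * (u x ^ 3 - u x)) ^ 2) ≤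
        ENNReal.ofReal (A ^ 2) →
      ∃ w : E → ℝ, Continuous w ∧ u =ᵐ[volume] w ∧ (∀ x, |w x| ≤ C) ∧
        ∀ x y, dist x y ≤ ε → |w x - w y| ≤ C / √ε * √(dist x y) := by
  obtain ⟨C, hC, hrep⟩ := exists_bounded_holder_representative_of_cubic E hd A
  refine ⟨C, hC, fun {ε u F Ω c} hε hε1 h hΩ hc huΩ hu hF hen => ?_⟩
  have hscaled {p : E → Prop} (hp : ∀ᵐ x, p x) : ∀ᵐ x, p (ε • x) := by
    simpa only [zero_add] using ae_comp_add_smul hp hε.ne' 0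
  have hscaledLp {h : E → ℝ} (hh : MemLp h 2) : MemLp (fun x => h (ε • x)) 2 := by
    simpa only [zero_add] using memLp_comp_add_smul hh hε.ne' 0
  have hlap := h.comp_smul hε.ne'
  have hmeas := hlap.locallyIntegrable.aestronglyMeasurable
  have hnorm := eLpNorm_two_le_of_lintegral_sq_le hA
    ((lintegral_rescaled_sq_le hd u F hε hε1).trans hen)
  have hfmeas : AEStronglyMeasurable fun x =>
      ε ^ 2 * F (ε • x) - (u (ε • x) ^ 3 - u (ε • x)) :=
    hlap.locallyIntegrable_laplacian.aestronglyMeasurable.sub ((hmeas.pow 3).sub hmeas)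
  have hΩε : Bornology.IsBounded ((ε⁻¹ • ·) '' Ω) := hΩ.smul₀ ε⁻¹
  obtain ⟨w, huw, hwC, hwL⟩ := hrep (c := c) hlap hΩε hc
    ((hscaled huΩ).mono fun x hx hxΩ => hx fun hmem => hxΩ ⟨_, hmem, inv_smul_smul₀ hε.ne' x⟩)
    (hscaledLp hu) ((hscaledLp hF).const_mul (ε ^ 2))
    ⟨hfmeas, hnorm.trans_lt ENNReal.ofReal_lt_top⟩
    ((toReal_eLpNorm hfmeas).symm.trans_le (ENNReal.toReal_le_of_le_ofReal hA hnorm))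
  have huw' := ae_comp_add_smul huw (inv_ne_zero hε.ne') 0
  refine ⟨fun x => w (ε⁻¹ • x),
    (uniformContinuous_of_abs_sub_le_sqrt_dist hwL).continuous.comp (continuous_const_smul _),
    huw'.mono fun x hx => ?_, fun x => hwC _, fun x y hxy => ?_⟩
  · simpa only [zero_add, smul_inv_smul₀ hε.ne'] using hx
  · have hdist : dist (ε⁻¹ • x) (ε⁻¹ • y) = ε⁻¹ * dist x y := by
      rw [dist_smul₀, Real.norm_of_nonneg (by positivity)]
    refine (hwL _ _ (by rwa [hdist, inv_mul_le_iff₀ hε, mul_one])).trans_eq ?_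
    rw [hdist, Real.sqrt_mul (by positivity), Real.sqrt_inv, div_eq_mul_inv, mul_assoc]

end CubicEstimate

section LocalConvergence

variable {E : Type*} [NormedAddCommGroup E] [MeasurableSpace E] {μ : Measure E} {f : ℕ → E → ℝ}
  {f₀ bound φ : E → ℝ}

theorem tendsto_setIntegral_abs_sub_of_dominated (hbound : LocallyIntegrable bound μ)
    (hf : ∀ k, AEStronglyMeasurable (f k) μ) (hle : ∀ k, ∀ᵐ x ∂μ, |f k x| ≤ bound x)
    (hlim : ∀ᵐ x ∂μ, Tendsto (fun k => f k x) atTop (𝓝 (f₀ x))) {K : Set E} (hK : IsCompact K) :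
    Tendsto (fun k => ∫ x in K, |f k x - f₀ x| ∂μ) atTop (𝓝 0) := by
  have hf₀ := aestronglyMeasurable_of_tendsto_ae atTop hf hlim
  have hle₀ : ∀ᵐ x ∂μ, |f₀ x| ≤ bound x := by
    filter_upwards [ae_all_iff.2 hle, hlim] with x hx hlimx
    exact le_of_tendsto' hlimx.abs hx
  have hint := (hbound.integrableOn_isCompact hK).add (hbound.integrableOn_isCompact hK)
  have h := tendsto_integral_of_dominated_convergence (μ := μ.restrict K)
    (F := fun k x => |f k x - f₀ x|) (f := fun _ => 0) (fun x => bound x + bound x)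
    (fun k => (((hf k).sub hf₀).norm).restrict) hint
    (fun k => ae_restrict_of_ae ?_) (ae_restrict_of_ae ?_)
  · simpa only [integral_zero] using h
  · filter_upwards [hle k, hle₀] with x hx hx₀
    rw [Real.norm_eq_abs, abs_abs]
    exact (abs_sub _ _).trans (add_le_add hx hx₀)
  · filter_upwards [hlim] with x hx
    simpa only [sub_self, abs_zero] using (hx.sub_const (f₀ x)).abs

theorem locallyIntegrable_abs (hf₀ : LocallyIntegrable f₀ μ) :
    LocallyIntegrable (fun x => |f₀ x|) μ := fun x =>
  let ⟨U, hU, h⟩ := hf₀ x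
  ⟨U, hU, h.abs⟩

variable [BorelSpace E]

theorem tendsto_integral_mul_of_tendsto_setIntegral_abs_sub (hf : ∀ k, LocallyIntegrable (f k) μ)
    (hf₀ : LocallyIntegrable f₀ μ)
    (hlim : ∀ K, IsCompact K → Tendsto (fun k => ∫ x in K, |f k x - f₀ x| ∂μ) atTop (𝓝 0))
    (hφ : Continuous φ) (hφc : HasCompactSupport φ) :
    Tendsto (fun k => ∫ x, f k x * φ x ∂μ) atTop (𝓝 (∫ x, f₀ x * φ x ∂μ)) := by
  have hint {g : E → ℝ} (hg : LocallyIntegrable g μ) : Integrable (fun x => g x * φ x) μ := by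
    simpa only [smul_eq_mul, mul_comm] using
      hg.integrable_smul_left_of_hasCompactSupport hφ hφc
  obtain ⟨M, hM⟩ := hφ.bounded_above_of_compact_support hφc
  have hbound (k : ℕ) : |(∫ x, f k x * φ x ∂μ) - ∫ x, f₀ x * φ x ∂μ| ≤
      (∫ x in tsupport φ, |f k x - f₀ x| ∂μ) * M := by
    have hsub : ∫ x, f k x * φ x - f₀ x * φ x ∂μ =
        ∫ x in tsupport φ, (f k x - f₀ x) * φ x ∂μ := by
      simp_rw [← sub_mul]
      refine (setIntegral_eq_integral_of_forall_compl_eq_zero fun x hx => ?_).symm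
      rw [image_eq_zero_of_notMem_tsupport hx, mul_zero]
    rw [← integral_sub (hint (hf k)) (hint hf₀), hsub, ← integral_mul_const]
    refine norm_integral_le_of_norm_le (f := fun x => (f k x - f₀ x) * φ x)
      ((((hf k).sub hf₀).integrableOn_isCompact hφc).abs.mul_const M) (ae_of_all _ fun x => ?_)
    rw [norm_mul]
    exact mul_le_mul_of_nonneg_left (hM x) (norm_nonneg _)
  refine tendsto_iff_norm_sub_tendsto_zero.2 (squeeze_zero (fun _ => norm_nonneg _) hbound ?_)
  simpa only [zero_mul] using (hlim _ hφc).mul_const M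

end LocalConvergence

section Mollify

variable {E : Type*} [NormedAddCommGroup E] [InnerProductSpace ℝ E] [FiniteDimensional ℝ E]
  [MeasurableSpace E] [BorelSpace E] {u g : E → ℝ} {q : ℝ → ℝ} {B : ℝ}

theorem locallyIntegrable_comp_mul (hq : Continuous q) (hB : ∀ s, |q s| ≤ B)
    (hu : AEStronglyMeasurable u) (hg : LocallyIntegrable g) :
    LocallyIntegrable fun x => q (u x) * g x := by
  refine (hg.smul B).mono ((hq.comp_aestronglyMeasurable hu).mul hg.aestronglyMeasurable)
    (ae_of_all _ fun x => ?_)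
  rw [norm_mul, Pi.smul_apply, norm_smul]
  exact mul_le_mul_of_nonneg_right ((hB _).trans (le_abs_self B)) (norm_nonneg _)

theorem tendsto_setIntegral_abs_comp_mollify_mul_sub (hq : Continuous q) (hB : ∀ s, |q s| ≤ B)
    (hu : LocallyIntegrable u) (hg : LocallyIntegrable g) {K : Set E} (hK : IsCompact K) :
    Tendsto (fun k => ∫ x in K, |q (mollify k u x) * mollify k g x - q (u x) * g x|) atTop
      (𝓝 0) := by
  have hqU (k : ℕ) : Continuous fun x => q (mollify k u x) :=
    hq.comp (contDiff_mollify hu).continuous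
  have hfirst := (tendsto_setIntegral_abs_mollify_sub hg hK).const_mul B
  have hsecond := tendsto_setIntegral_abs_sub_of_dominated (μ := volume)
    (f := fun k x => q (mollify k u x) * g x) (f₀ := fun x => q (u x) * g x)
    (bound := fun x => B * |g x|) ((locallyIntegrable_abs hg).smul B)
    (fun k => (hqU k).aestronglyMeasurable.mul hg.aestronglyMeasurable)
    (fun k => ae_of_all _ fun x => ?_) ?_ hK
  · have hlim := hfirst.add hsecond
    rw [mul_zero, add_zero] at hlim
    refine squeeze_zero (fun k => integral_nonneg fun x => abs_nonneg _) (fun k => ?_) hlim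
    have hint₁ : IntegrableOn (fun x => B * |mollify k g x - g x|) K :=
      (((contDiff_mollify hg).continuous.locallyIntegrable.sub
        hg).integrableOn_isCompact hK).abs.const_mul B
    have hint₂ : IntegrableOn (fun x => |q (mollify k u x) * g x - q (u x) * g x|) K :=
      (((locallyIntegrable_comp_mul hq hB (contDiff_mollify hu).continuous.aestronglyMeasurable
        hg).sub (locallyIntegrable_comp_mul hq hB hu.aestronglyMeasurable
        hg)).integrableOn_isCompact hK).abs
    rw [← integral_const_mul, ← integral_add hint₁ hint₂]
    refine integral_mono_of_nonneg (ae_of_all _ fun x => abs_nonneg _) (hint₁.add hint₂)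
      (ae_of_all _ fun x => (abs_sub_le _ (q (mollify k u x) * g x) _).trans ?_)
    rw [← mul_sub, abs_mul]
    exact add_le_add_left (mul_le_mul_of_nonneg_right (hB _) (abs_nonneg _)) _
  · rw [abs_mul]
    exact mul_le_mul_of_nonneg_right (hB _) (abs_nonneg _)
  · filter_upwards [ae_tendsto_mollify hu] with x hx
    exact ((hq.tendsto (u x)).comp hx).mul_const _

end Mollify

section WeakPartialDeriv

variable {n : ℕ} {i : Fin n} {u g w : EuclideanSpace ℝ (Fin n) → ℝ}

theorem HasWeakPartialDeriv.ae_eq (hg : HasWeakPartialDeriv i u g)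
    (hw : HasWeakPartialDeriv i u w) : g =ᵐ[volume] w := by
  refine ae_eq_of_integral_contDiff_smul_eq hg.2.1 hw.2.1 fun φ hφ hφc => ?_
  simpa only [smul_eq_mul, mul_comm, neg_inj] using
    (hg.2.2 φ hφ hφc).symm.trans (hw.2.2 φ hφ hφc)

theorem HasWeakPartialDeriv.congr_left (h : HasWeakPartialDeriv i u g) (huw : u =ᵐ[volume] w) :
    HasWeakPartialDeriv i w g := by
  refine ⟨h.1.congr huw, h.2.1, fun φ hφ hφc => ?_⟩
  rw [← h.2.2 φ hφ hφc]
  exact integral_congr_ae (huw.mono fun x hx => by simp only [hx])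

theorem HasWeakPartialDeriv.hasWeakPartialDeriv_weakPartialDeriv
    (h : HasWeakPartialDeriv i u g) : HasWeakPartialDeriv i u (weakPartialDeriv i u) := by
  have hex : ∃ g, HasWeakPartialDeriv i u g := ⟨g, h⟩
  rw [weakPartialDeriv, dif_pos hex]
  exact hex.choose_spec

theorem HasWeakPartialDeriv.ae_eq_weakPartialDeriv (h : HasWeakPartialDeriv i u g) :
    g =ᵐ[volume] weakPartialDeriv i u :=
  h.ae_eq h.hasWeakPartialDeriv_weakPartialDeriv

theorem hasWeakPartialDeriv_of_tendsto {v p : ℕ → EuclideanSpace ℝ (Fin n) → ℝ}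
    (h : ∀ k, HasWeakPartialDeriv i (v k) (p k)) (hu : LocallyIntegrable u)
    (hg : LocallyIntegrable g)
    (hv : ∀ K, IsCompact K → Tendsto (fun k => ∫ x in K, |v k x - u x|) atTop (𝓝 0))
    (hp : ∀ K, IsCompact K → Tendsto (fun k => ∫ x in K, |p k x - g x|) atTop (𝓝 0)) :
    HasWeakPartialDeriv i u g := by
  refine ⟨hu, hg, fun φ hφ hφc => ?_⟩
  have hleft := tendsto_integral_mul_of_tendsto_setIntegral_abs_sub (fun k => (h k).1) hu hv
    (contDiff_fderiv_apply hφ (EuclideanSpace.single i 1)).continuous (hφc.fderiv_apply ℝ _)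
  have hright := tendsto_integral_mul_of_tendsto_setIntegral_abs_sub (fun k => (h k).2.1) hg hp
    hφ.continuous hφc
  exact tendsto_nhds_unique (hleft.congr fun k => (h k).2.2 φ hφ hφc) hright.neg

theorem hasWeakPartialDeriv_of_contDiff (hu : ContDiff ℝ 1 u) :
    HasWeakPartialDeriv i u fun x => fderiv ℝ u x (EuclideanSpace.single i 1) := by
  have hu' : Continuous fun x => fderiv ℝ u x (EuclideanSpace.single i 1) :=
    (hu.continuous_fderiv one_ne_zero).clm_apply continuous_const
  refine ⟨hu.continuous.locallyIntegrable, hu'.locallyIntegrable, fun φ hφ hφc => ?_⟩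
  exact integral_mul_fderiv_eq_neg_fderiv_mul_of_integrable
    ((hu'.mul hφ.continuous).integrable_of_hasCompactSupport hφc.mul_left)
    ((hu.continuous.mul (contDiff_fderiv_apply hφ _).continuous).integrable_of_hasCompactSupport
      (hφc.fderiv_apply ℝ _).mul_left)
    ((hu.continuous.mul hφ.continuous).integrable_of_hasCompactSupport hφc.mul_left)
    (fun x _ => hu.differentiable one_ne_zero x) fun x _ => hφ.differentiable (by simp) x

theorem HasWeakPartialDeriv.fderiv_mollify (h : HasWeakPartialDeriv i u g) (k : ℕ)
    (x : EuclideanSpace ℝ (Fin n)) :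
    fderiv ℝ (mollify k u) x (EuclideanSpace.single i 1) = mollify k g x := by
  set ρ := (bump (EuclideanSpace ℝ (Fin n)) k).normed volume
  have hρd : ContDiff ℝ ∞ ρ := (bump _ k).contDiff_normed
  have hρc : HasCompactSupport ρ := (bump _ k).hasCompactSupport_normed
  have hφd : ContDiff ℝ ∞ fun y => ρ (x - y) := hρd.comp (contDiff_const.sub contDiff_id)
  have hφc : HasCompactSupport fun y => ρ (x - y) := hρc.comp_homeomorph (Homeomorph.subLeft x)
  have hfd (y : EuclideanSpace ℝ (Fin n)) :
      fderiv ℝ (fun y => ρ (x - y)) y = -fderiv ℝ ρ (x - y) := by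
    have hd := (hρd.differentiable (by simp) (x - y)).hasFDerivAt.comp y
      ((hasFDerivAt_id y).const_sub x)
    exact hd.fderiv.trans (by ext; simp)
  have hweak := h.2.2 _ hφd hφc
  rw [mollify, mollify, fderiv_convolution_apply (contDiff_infty.1 hρd 1) hρc h.1,
    convolution_eq_swap, convolution_eq_swap]
  simpa only [hfd, ContinuousLinearMap.lsmul_apply, smul_eq_mul, mul_comm,
    neg_apply, mul_neg, integral_neg, neg_inj] using hweak

theorem HasWeakPartialDeriv.comp (h : HasWeakPartialDeriv i u g) {p q : ℝ → ℝ} {B : ℝ}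
    (hp : ∀ s, HasDerivAt p (q s) s) (hq : Continuous q) (hB : ∀ s, |q s| ≤ B) :
    HasWeakPartialDeriv i (fun x => p (u x)) fun x => q (u x) * g x := by
  have hp1 : ContDiff ℝ 1 p := contDiff_one_iff_deriv.2
    ⟨fun s => (hp s).differentiableAt, by rwa [funext fun s => (hp s).deriv]⟩
  have hlip (s t : ℝ) : |p s - p t| ≤ B * |s - t| :=
    convex_univ.norm_image_sub_le_of_norm_hasDerivWithin_le
      (fun s _ => (hp s).hasDerivWithinAt) (fun s _ => hB s) (mem_univ t) (mem_univ s)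
  have hpu : LocallyIntegrable fun x => p (u x) := by
    refine ((locallyIntegrable_const (|p 0|)).add ((locallyIntegrable_abs h.1).smul B)).mono
      (hp1.continuous.comp_aestronglyMeasurable h.1.aestronglyMeasurable) (ae_of_all _ fun x => ?_)
    have h0 := hlip (u x) 0
    have h1 := abs_sub_abs_le_abs_sub (p (u x)) (p 0)
    rw [sub_zero] at h0
    refine le_trans ?_ (le_abs_self _)
    simp only [Pi.add_apply, Pi.smul_apply, smul_eq_mul, Real.norm_eq_abs]
    linarith
  refine hasWeakPartialDeriv_of_tendsto (v := fun k x => p (mollify k u x))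
    (p := fun k x => q (mollify k u x) * mollify k g x) (fun k => ?_) hpu
    (locallyIntegrable_comp_mul hq hB h.1.aestronglyMeasurable h.2.1) (fun K hK => ?_)
    fun K hK => tendsto_setIntegral_abs_comp_mollify_mul_sub hq hB h.1 h.2.1 hK
  · have hU : ContDiff ℝ 1 (mollify k u) := contDiff_infty.1 (contDiff_mollify h.1) 1
    have hchain (x : EuclideanSpace ℝ (Fin n)) :
        fderiv ℝ (fun x => p (mollify k u x)) x (EuclideanSpace.single i 1) =
          q (mollify k u x) * mollify k g x := by
      have hd := (hp _).comp_hasFDerivAt x (hU.differentiable one_ne_zero x).hasFDerivAt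
      rw [show (fun x => p (mollify k u x)) = p ∘ mollify k u from rfl, hd.fderiv, smul_apply,
        h.fderiv_mollify, smul_eq_mul]
    simpa only [hchain] using
      hasWeakPartialDeriv_of_contDiff (i := i) (u := fun x => p (mollify k u x)) (hp1.comp hU)
  · have hlim := (tendsto_setIntegral_abs_mollify_sub h.1 hK).const_mul B
    rw [mul_zero] at hlim
    refine squeeze_zero (fun k => integral_nonneg fun x => abs_nonneg _) (fun k => ?_) hlim
    rw [← integral_const_mul]
    have hint : IntegrableOn (fun x => B * |mollify k u x - u x|) K :=
      (((contDiff_mollify h.1).continuous.locallyIntegrable.sub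
        h.1).integrableOn_isCompact hK).abs.const_mul B
    exact integral_mono_of_nonneg (ae_of_all _ fun x => abs_nonneg _) hint
      (ae_of_all _ fun x => hlip _ _)

theorem hasDerivAt_arctan_mul_sub_div {m : ℝ} (hm : m ≠ 0) (c s : ℝ) :
    HasDerivAt (fun t => Real.arctan (m * (t - c)) / m) (1 / (1 + (m * (s - c)) ^ 2)) s := by
  have hlin : HasDerivAt (fun t => m * (t - c)) m s := by
    simpa using ((hasDerivAt_id s).sub_const c).const_mul m
  refine (hlin.arctan.div_const m).congr_deriv ?_
  field_simp

theorem abs_one_div_one_add_sq_le_one (t : ℝ) : |1 / (1 + t ^ 2)| ≤ 1 := by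
  rw [abs_of_nonneg (by positivity), div_le_one (by positivity)]
  exact le_add_of_nonneg_right (sq_nonneg t)

theorem tendsto_one_div_one_add_mul_sq (t : ℝ) :
    Tendsto (fun j : ℕ => 1 / (1 + (((j : ℝ) + 1) * t) ^ 2)) atTop
      (𝓝 (if t = 0 then 1 else 0)) := by
  split_ifs with ht
  · simp [ht]
  · refine Tendsto.div_atTop tendsto_const_nhds (tendsto_atTop_add_const_left _ _ ?_)
    simp_rw [mul_pow]
    refine Tendsto.atTop_mul_const (by positivity) ?_
    exact (tendsto_pow_atTop two_ne_zero).comp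
      (tendsto_atTop_add_const_right _ _ tendsto_natCast_atTop_atTop)

theorem abs_arctan_mul_div_le (j : ℕ) (t : ℝ) :
    |Real.arctan (((j : ℝ) + 1) * t) / ((j : ℝ) + 1)| ≤ Real.pi / 2 * (1 / ((j : ℝ) + 1)) := by
  rw [abs_div, abs_of_pos (by positivity : (0 : ℝ) < (j : ℝ) + 1), mul_one_div]
  gcongr
  exact abs_le.2 ⟨(Real.neg_pi_div_two_lt_arctan _).le, (Real.arctan_lt_pi_div_two _).le⟩

theorem tendsto_arctan_mul_div (t : ℝ) :
    Tendsto (fun j : ℕ => Real.arctan (((j : ℝ) + 1) * t) / ((j : ℝ) + 1)) atTop (𝓝 0) := by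
  refine squeeze_zero_norm (fun j => abs_arctan_mul_div_le j t) ?_
  simpa using tendsto_one_div_add_atTop_nhds_zero_nat.const_mul (Real.pi / 2)

/-- The truncations `arctan (j (u - c)) / j` tend to `0` uniformly, while their derivatives tend to
the derivative of `u` on `{u = c}` and to `0` elsewhere. -/
theorem HasWeakPartialDeriv.zero_ite_eq_const (h : HasWeakPartialDeriv i u g) (c : ℝ) :
    HasWeakPartialDeriv i 0 fun x => (if u x - c = 0 then 1 else 0) * g x := by
  set p : ℕ → ℝ → ℝ := fun j s => Real.arctan (((j : ℝ) + 1) * (s - c)) / ((j : ℝ) + 1)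
  set q : ℕ → ℝ → ℝ := fun j s => 1 / (1 + (((j : ℝ) + 1) * (s - c)) ^ 2)
  have hq (j : ℕ) : Continuous (q j) :=
    continuous_const.div (by fun_prop) fun s => by positivity
  have hchain (j : ℕ) : HasWeakPartialDeriv i (fun x => p j (u x)) fun x => q j (u x) * g x :=
    h.comp (hasDerivAt_arctan_mul_sub_div (by positivity) c) (hq j)
      fun s => abs_one_div_one_add_sq_le_one _
  have hqlim : ∀ᵐ x, Tendsto (fun j => q j (u x) * g x) atTop
      (𝓝 ((if u x - c = 0 then 1 else 0) * g x)) :=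
    ae_of_all _ fun x => (tendsto_one_div_one_add_mul_sq (u x - c)).mul_const (g x)
  have hqmeas (j : ℕ) := (hchain j).2.1.aestronglyMeasurable
  have hlim : LocallyIntegrable fun x => (if u x - c = 0 then 1 else 0) * g x := by
    refine h.2.1.mono (aestronglyMeasurable_of_tendsto_ae atTop hqmeas hqlim)
      (ae_of_all _ fun x => ?_)
    split_ifs <;> simp
  refine hasWeakPartialDeriv_of_tendsto hchain locallyIntegrable_zero hlim
    (fun K hK => tendsto_setIntegral_abs_sub_of_dominated (locallyIntegrable_const (Real.pi / 2))
      (fun j => (hchain j).1.aestronglyMeasurable) (fun j => ae_of_all _ fun x => ?_)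
      (ae_of_all _ fun x => tendsto_arctan_mul_div (u x - c)) hK)
    fun K hK => tendsto_setIntegral_abs_sub_of_dominated (locallyIntegrable_abs h.2.1) hqmeas
      (fun j => ae_of_all _ fun x => ?_) hqlim hK
  · refine (abs_arctan_mul_div_le j (u x - c)).trans (mul_le_of_le_one_right (by positivity) ?_)
    rw [div_le_one (by positivity)]
    exact le_add_of_nonneg_left j.cast_nonneg
  · rw [abs_mul]
    exact mul_le_of_le_one_left (abs_nonneg _) (abs_one_div_one_add_sq_le_one _)

theorem HasWeakPartialDeriv.ae_eq_zero_of_eq_const (h : HasWeakPartialDeriv i u g) (c : ℝ) :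
    ∀ᵐ x, u x = c → g x = 0 := by
  have hconst := hasWeakPartialDeriv_of_contDiff (i := i)
    (contDiff_zero_fun : ContDiff ℝ 1 fun _ : EuclideanSpace ℝ (Fin n) => (0 : ℝ))
  filter_upwards [(h.zero_ite_eq_const c).ae_eq hconst] with x hx hux
  simpa [hux] using hx

end WeakPartialDeriv

section WeakLaplacianOfPartialDeriv

variable {n : ℕ} {u g : EuclideanSpace ℝ (Fin n) → ℝ} {G H : Fin n → EuclideanSpace ℝ (Fin n) → ℝ}
  {Ω : Set (EuclideanSpace ℝ (Fin n))} {c : ℝ}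

theorem MemL2Loc.locallyIntegrable (hu : MemL2Loc u) : LocallyIntegrable u := by
  refine (locallyIntegrable_iff (μ := volume)).2 fun K hK => ?_
  have : IsFiniteMeasure (volume.restrict K) := ⟨by simpa using hK.measure_lt_top⟩
  exact (hu K hK).integrable one_le_two

theorem MemL2Loc.memLp_sub_const (hu : MemL2Loc u) (hΩ : Bornology.IsBounded Ω)
    (huΩ : ∀ᵐ x, x ∉ Ω → u x = c) : MemLp (fun x => u x - c) 2 := by
  have hK : IsCompact (closure Ω) := hΩ.isCompact_closure
  have : IsFiniteMeasure (volume.restrict (closure Ω)) := ⟨by simpa using hK.measure_lt_top⟩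
  refine ((memLp_indicator_iff_restrict isClosed_closure.measurableSet).2
    ((hu _ hK).sub (memLp_const c))).ae_eq ?_
  filter_upwards [huΩ] with x hx
  by_cases hxΩ : x ∈ closure Ω
  · rw [indicator_of_mem hxΩ, Pi.sub_apply]
  · rw [indicator_of_notMem hxΩ, hx fun h => hxΩ (subset_closure h), sub_self]

theorem MemL2Loc.congr (hu : MemL2Loc u) (hug : u =ᵐ[volume] g) : MemL2Loc g := fun K hK =>
  (hu K hK).ae_eq (ae_restrict_of_ae hug)

theorem hasWeakLaplacian_of_hasWeakPartialDeriv (hu : LocallyIntegrable u)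
    (hG : ∀ i, HasWeakPartialDeriv i u (G i)) (hH : ∀ i, HasWeakPartialDeriv i (G i) (H i)) :
    HasWeakLaplacian u fun x => ∑ i, H i x := by
  refine ⟨hu, locallyIntegrable_finsetSum _ fun i _ => (hH i).2.1, fun φ hφ hφc => ?_⟩
  have hφi (i : Fin n) := contDiff_fderiv_apply hφ (EuclideanSpace.single i (1 : ℝ))
  have hφci (i : Fin n) := hφc.fderiv_apply ℝ (EuclideanSpace.single i (1 : ℝ))
  have hint {w χ : EuclideanSpace ℝ (Fin n) → ℝ} (hw : LocallyIntegrable w)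
      (hχ : ContDiff ℝ ∞ χ) (hχc : HasCompactSupport χ) : Integrable fun x => w x * χ x := by
    simpa only [smul_eq_mul, mul_comm] using
      hw.integrable_smul_left_of_hasCompactSupport hχ.continuous hχc
  simp_rw [laplacian_eq_sum_fderiv_fderiv (EuclideanSpace.basisFun (Fin n) ℝ)
    (contDiff_infty.1 hφ 2), EuclideanSpace.basisFun_apply, Finset.mul_sum, Finset.sum_mul]
  rw [integral_finsetSum _ fun i _ => hint hu (contDiff_fderiv_apply (hφi i) _)
    ((hφci i).fderiv_apply ℝ _), integral_finsetSum _ fun i _ => hint (hH i).2.1 hφ hφc]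
  refine Finset.sum_congr rfl fun i _ => ?_
  rw [(hG i).2.2 _ (hφi i) (hφci i), (hH i).2.2 φ hφ hφc, neg_neg]

theorem MemW22Loc.hasWeakPartialDeriv (hu : MemW22Loc u) (i : Fin n) :
    MemL2Loc (weakPartialDeriv i u) ∧ HasWeakPartialDeriv i u (weakPartialDeriv i u) ∧
      MemL2Loc (weakPartialDeriv i (weakPartialDeriv i u)) ∧
      HasWeakPartialDeriv i (weakPartialDeriv i u)
        (weakPartialDeriv i (weakPartialDeriv i u)) := by
  obtain ⟨-, g, h, hg, hh⟩ := hu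
  have hhi := (hh i i).2.congr_left (hg i).2.ae_eq_weakPartialDeriv
  exact ⟨(hg i).1.congr (hg i).2.ae_eq_weakPartialDeriv,
    (hg i).2.hasWeakPartialDeriv_weakPartialDeriv, (hh i i).1.congr hhi.ae_eq_weakPartialDeriv,
    hhi.hasWeakPartialDeriv_weakPartialDeriv⟩

theorem MemW22Loc.hasWeakLaplacian (hu : MemW22Loc u) : HasWeakLaplacian u (weakLaplacian u) :=
  hasWeakLaplacian_of_hasWeakPartialDeriv hu.1.locallyIntegrable
    (fun i => (hu.hasWeakPartialDeriv i).2.1) fun i => (hu.hasWeakPartialDeriv i).2.2.2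

theorem MemW22Loc.memL2Loc_weakLaplacian (hu : MemW22Loc u) : MemL2Loc (weakLaplacian u) :=
  fun K hK => memLp_finsetSum _ fun i _ => (hu.hasWeakPartialDeriv i).2.2.1 K hK

theorem MemW22Loc.weakLaplacian_ae_eq_zero_of_eq_const (hu : MemW22Loc u) (c : ℝ) :
    ∀ᵐ x, u x = c → weakLaplacian u x = 0 := by
  filter_upwards [ae_all_iff.2 fun i => (hu.hasWeakPartialDeriv i).2.1.ae_eq_zero_of_eq_const c,
    ae_all_iff.2 fun i => (hu.hasWeakPartialDeriv i).2.2.2.ae_eq_zero_of_eq_const 0]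
    with x hfirst hsecond hx
  exact Finset.sum_eq_zero fun i _ => hsecond i (hfirst i hx)

end WeakLaplacianOfPartialDeriv

section DiffuseWillmore

variable {n : ℕ} {u : EuclideanSpace ℝ (Fin n) → ℝ} {Ω : Set (EuclideanSpace ℝ (Fin n))} {ε a : ℝ}

theorem deriv_doubleWell (s : ℝ) : deriv doubleWell s = s ^ 3 - s := by
  have h : HasDerivAt doubleWell (s ^ 3 - s) s := by
    refine ((((hasDerivAt_id s).pow 2).sub_const 1).pow 2).div_const 4 |>.congr_deriv ?_
    simp
    ring
  exact h.deriv

theorem surfaceConst_pos : 0 < surfaceConst := by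
  have hc : Continuous fun s : ℝ => √(2 * doubleWell s) := by
    unfold doubleWell
    fun_prop
  refine intervalIntegral.intervalIntegral_pos_of_pos_on (hc.intervalIntegrable _ _)
    (fun s hs => Real.sqrt_pos.2 ?_) (by norm_num)
  have : s ^ 2 - 1 ≠ 0 := by nlinarith [hs.1, hs.2]
  unfold doubleWell
  positivity

theorem mem_phaseFieldSpace_of_diffuseWillmore_ne_top (h : diffuseWillmore Ω ε u ≠ ⊤) :
    u ∈ phaseFieldSpace Ω := by
  by_contra hu
  exact h (if_neg hu)

/-- Outside `Ω` the energy density vanishes: `u = -1` there, and `Δu = 0` almost everywhere on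
the level set `{u = -1}`. -/
theorem lintegral_le_of_diffuseWillmore_le (hW : diffuseWillmore Ω ε u ≤ ENNReal.ofReal a) :
    ∫⁻ x, ENNReal.ofReal (1 / ε * (ε * weakLaplacian u x - 1 / ε * (u x ^ 3 - u x)) ^ 2) ≤
      ENNReal.ofReal (surfaceConst * a) := by
  have hu := mem_phaseFieldSpace_of_diffuseWillmore_ne_top (ne_top_of_le_ne_top
    ENNReal.ofReal_ne_top hW)
  rw [diffuseWillmore, if_pos hu] at hW
  simp_rw [deriv_doubleWell] at hW
  set e : EuclideanSpace ℝ (Fin n) → ℝ≥0∞ := fun x =>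
    ENNReal.ofReal (1 / ε * (ε * weakLaplacian u x - 1 / ε * (u x ^ 3 - u x)) ^ 2)
  have hout : ∀ᵐ x, x ∉ toMeasurable volume Ω → e x = 0 := by
    filter_upwards [hu.1.weakLaplacian_ae_eq_zero_of_eq_const (-1), hu.2] with x hΔ hx hxΩ
    have hux := hx fun h => hxΩ (subset_toMeasurable volume Ω h)
    simp only [e, hΔ hux, hux]
    norm_num
  have hset : ∫⁻ x, e x = ∫⁻ x in Ω, e x := by
    rw [← Measure.restrict_toMeasurable_of_sFinite, ← lintegral_indicator
      (measurableSet_toMeasurable _ _)]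
    refine lintegral_congr_ae (hout.mono fun x hx => ?_)
    by_cases hxΩ : x ∈ toMeasurable volume Ω
    · rw [indicator_of_mem hxΩ]
    · rw [indicator_of_notMem hxΩ, hx hxΩ]
  have hc := surfaceConst_pos
  calc ∫⁻ x, e x
      = ENNReal.ofReal surfaceConst * (ENNReal.ofReal (1 / surfaceConst) * ∫⁻ x in Ω, e x) := by
        rw [hset, ← mul_assoc, ← ENNReal.ofReal_mul hc.le, mul_one_div_cancel hc.ne',
          ENNReal.ofReal_one, one_mul]
    _ ≤ ENNReal.ofReal surfaceConst * ENNReal.ofReal a := by gcongr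
    _ = ENNReal.ofReal (surfaceConst * a) := (ENNReal.ofReal_mul hc.le).symm

theorem exists_bounded_holder_representative_of_diffuseWillmore_le (hn : n ≤ 3) (ha : 0 ≤ a) :
    ∃ C : ℝ≥0, ∀ {ε : ℝ} {Ω : Set (EuclideanSpace ℝ (Fin n))} {u : EuclideanSpace ℝ (Fin n) → ℝ},
      0 < ε → ε ≤ 1 → Bornology.IsBounded Ω → diffuseWillmore Ω ε u ≤ ENNReal.ofReal a →
      eLpNorm u ∞ volume ≤ C ∧ ∃ v : EuclideanSpace ℝ (Fin n) → ℝ, Continuous v ∧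
        v =ᵐ[volume] u ∧ ∀ x y, dist x y ≤ ε → |v x - v y| ≤ C / √ε * √(dist x y) := by
  have hA : 0 ≤ surfaceConst * a := mul_nonneg surfaceConst_pos.le ha
  obtain ⟨C, hC, hrep⟩ := exists_bounded_holder_representative_of_rescaled_cubic
    (E := EuclideanSpace ℝ (Fin n)) (by simpa using hn) (Real.sqrt_nonneg (surfaceConst * a))
  refine ⟨C.toNNReal, fun {ε Ω u} hε hε1 hΩ hW => ?_⟩
  obtain ⟨hu, huΩ⟩ := mem_phaseFieldSpace_of_diffuseWillmore_ne_top (ne_top_of_le_ne_top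
    ENNReal.ofReal_ne_top hW)
  have hΔΩ : ∀ᵐ x, x ∉ Ω → weakLaplacian u x = 0 := by
    filter_upwards [hu.weakLaplacian_ae_eq_zero_of_eq_const (-1), huΩ] with x hx hxΩ h
    exact hx (hxΩ h)
  have hΔ : MemLp (weakLaplacian u) 2 := by
    simpa only [sub_zero] using hu.memL2Loc_weakLaplacian.memLp_sub_const hΩ hΔΩ
  obtain ⟨v, hvc, huv, hvC, hvL⟩ := hrep hε hε1 hu.hasWeakLaplacian hΩ (by norm_num) huΩ
    (hu.1.memLp_sub_const hΩ huΩ) hΔ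
    ((lintegral_le_of_diffuseWillmore_le hW).trans_eq (by rw [Real.sq_sqrt hA]))
  refine ⟨?_, v, hvc, huv.symm, by rwa [Real.coe_toNNReal C hC]⟩
  rw [eLpNorm_exponent_top]
  exact eLpNormEssSup_le_of_ae_bound (huv.mono fun x hx => by rw [hx]; exact hvC x)

end DiffuseWillmore

end PhaseField

theorem mainTheorem7_general (n : ℕ) (hn : n ≤ 3) (α : ℝ≥0) :
    ∃ C : ℝ≥0, ∀ (Ω : Set (EuclideanSpace ℝ (Fin n))), Bornology.IsBounded Ω →
      ∀ u : ℝ → EuclideanSpace ℝ (Fin n) → ℝ,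
        limsup (fun ε => PhaseField.diffuseWillmore Ω ε (u ε)) (𝓝[>] (0 : ℝ)) ≤ (α : ℝ≥0∞) →
        ∃ ε₀ : ℝ, 0 < ε₀ ∧ ∀ ε, 0 < ε → ε < ε₀ →
          eLpNorm (u ε) ∞ volume ≤ (C : ℝ≥0∞) ∧
          ∃ v : EuclideanSpace ℝ (Fin n) → ℝ, Continuous v ∧ v =ᵐ[volume] u ε ∧
            ∀ x, ∀ y ∈ Metric.ball x ε, |v x - v y| ≤ C / √ε * √(dist x y) := by
  obtain ⟨C, hC⟩ := PhaseField.exists_bounded_holder_representative_of_diffuseWillmore_le hn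
    (by positivity : 0 ≤ (α : ℝ) + 1)
  refine ⟨C, fun Ω hΩ u hlim => ?_⟩
  have hev : ∀ᶠ ε in 𝓝[>] (0 : ℝ), PhaseField.diffuseWillmore Ω ε (u ε) < (α : ℝ≥0∞) + 1 :=
    eventually_lt_of_limsup_lt
      (hlim.trans_lt (ENNReal.lt_add_right ENNReal.coe_ne_top one_ne_zero))
  obtain ⟨b, hb, hbound⟩ := mem_nhdsGT_iff_exists_Ioo_subset.1 hev
  refine ⟨min b 1, lt_min hb one_pos, fun ε hε hε₀ => ?_⟩
  have hW : PhaseField.diffuseWillmore Ω ε (u ε) ≤ ENNReal.ofReal ((α : ℝ) + 1) := by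
    rw [ENNReal.ofReal_add α.coe_nonneg zero_le_one, ENNReal.ofReal_coe_nnreal, ENNReal.ofReal_one]
    exact (hbound ⟨hε, hε₀.trans_le (min_le_left _ _)⟩ : _ < _).le
  obtain ⟨hu, v, hvc, hvu, hvL⟩ := hC hε (hε₀.le.trans (min_le_right _ _)) hΩ hW
  exact ⟨hu, v, hvc, hvu, fun x y hy => hvL x y (Metric.mem_ball'.1 hy).le⟩

theorem mainTheorem7 (n : ℕ) (hn : n = 2 ∨ n = 3) (α : ℝ≥0) :
    ∃ C : ℝ≥0, ∀ (Ω : Set (EuclideanSpace ℝ (Fin n))), IsOpen Ω → Bornology.IsBounded Ω →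
      ∀ u : ℝ → EuclideanSpace ℝ (Fin n) → ℝ,
        (∀ ε, 0 < ε → u ε ∈ PhaseField.phaseFieldSpace Ω) →
        limsup (fun ε => PhaseField.diffuseWillmore Ω ε (u ε)) (𝓝[>] (0 : ℝ)) ≤ (α : ℝ≥0∞) →
        ∃ ε₀ : ℝ, 0 < ε₀ ∧ ∀ ε, 0 < ε → ε < ε₀ →
          eLpNorm (u ε) ∞ volume ≤ (C : ℝ≥0∞) ∧
          ∃ v : EuclideanSpace ℝ (Fin n) → ℝ, Continuous v ∧ v =ᵐ[volume] u ε ∧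
            ∀ x, ∀ y ∈ Metric.ball x ε, |v x - v y| ≤ C / √ε * √(dist x y) := by
  obtain ⟨C, hC⟩ := mainTheorem7_general n (by omega) α
  exact ⟨C, fun Ω _ hΩ u _ hlim => hC Ω hΩ u hlim⟩
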